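/- (Conditional Markov Lemma for Mutual Covering.) There is a function $\delta$ with $\delta(\epsilon)\to0$ as $\epsilon\downarrow0$ such that the following holds. Let $(X_1,X_2,U_1,U_2,U_{11},U_{12},U_{21},U_{22})$ be random variables with values in arbitrary finite sets $\mathcal X_1,\mathcal X_2,\mathcal U_1,\mathcal U_2,\mathcal U_{11},\mathcal U_{12},\mathcal U_{21},\mathcal U_{22}$ that satisfy the Markov condition $$(U_1,U_{11},U_{12})\leftrightarrow X_1\leftrightarrow X_2\leftrightarrow(U_2,U_{21},U_{22}),$$ and let $R_1,R_{11},R_{12},R_2,R_{21},R_{22}\ge0$ satisfy (information quantities in bits) $$\begin{aligned} &R_1>I(X_1;U_1),\qquad R_2>I(X_2;U_2),\\ &R_1+R_{11}>I(X_1;U_{11},U_1),\qquad R_1+R_{12}>I(X_1;U_{12},U_1),\\ &R_2+R_{21}>I(X_2;U_{21},U_2),\qquad R_2+R_{22}>I(X_2;U_{22},U_2),\\ &R_1+R_{11}+R_{12}>I(X_1;U_{11},U_{12},U_1)+I(U_{11};U_{12}|U_1),\\ &R_2+R_{22}+R_{21}>I(X_2;U_{21},U_{22},U_2)+I(U_{21};U_{22}|U_2).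 \end{aligned}$$ Let $(X_1^n,X_2^n)$ be $n$ i.i.d. copies of $(X_1,X_2)$. Independently of them, and independently for $a=1,2$, generate random codebooks of block length $n$: $\lfloor 2^{nR_a}\rfloor$ independent codewords $\overline U_{a,i}$ with i.i.d. letters of law $P_{U_a}$ and, for each $i$ and $b=1,2$, given the codewords $\overline U_{a,i}$, $\lfloor 2^{nR_{ab}}\rfloor$ codewords $\overline U_{ab,ij}$, all conditionally independent, with letters drawn independently according to $\prod_{t=1}^nP_{U_{ab}|U_a}(\cdot\,|\,\overline U_{a,i}^{(t)})$. Then for every $\epsilon>0$ and all sufficiently large $n$ there exist, for $a=1,2$, functions $U_a^*(X_a^n)$, $U_{a1}^*(X_a^n,U_a^*)$ and $U_{a2}^*(X_a^n,U_a^*)$, determined by the codebook of terminal $a$, with values in $\mathcal U_a^n$, $\mathcal U_{a1}^n$ and $\mathcal U_{a2}^n$, which always pick codewords, in the sense that $U_a^*=\overline U_{a,i}$, $U_{a1}^*=\overline U_{a1,ij}$ and $U_{a2}^*=\overline U_{a2,ik}$ for some $i,j,k$, such that $$P\left((X_1^n,X_2^n,U_1^*,U_2^*,U_{11}^*,U_{12}^*,U_{21}^*,U_{22}^*)\in\mathcal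 T_\epsilon^n\right)\ge1-\delta(\epsilon).$$ Here the probability is over the sources and the codebooks, and $\mathcal T_\epsilon^n$ is the set of strongly jointly $\epsilon$-typical sequences: those in which the relative frequency of every tuple $a$ of letters differs from its probability $p(a)$ by at most $\epsilon\,p(a)$. -/

import Mathlib

open MeasureTheory Filter Topology

noncomputable section

namespace MutualCovering

/-- Probability mass function of a finite-valued random variable: `P (X = a)`. -/
def pmf {Ω α : Type*} [MeasurableSpace Ω] (μ : Measure Ω) (X : Ω → α) (a : α) : ℝ :=
  μ.real (X ⁻¹' {a})

/-- Conditional mass function `P (V = v | U = u)`. Its value where `P (U = u) = 0` is immaterial: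
below it is only ever weighted with `P (U = u)`. -/
def condPmf {Ω α β : Type*} [MeasurableSpace Ω] (μ : Measure Ω) (V : Ω → β) (U : Ω → α)
    (v : β) (u : α) : ℝ :=
  pmf μ (fun ω => (U ω, V ω)) (u, v) / pmf μ U u

/-- Shannon entropy `H(X)` in bits. -/
def entropy {Ω α : Type*} [MeasurableSpace Ω] [Fintype α] (μ : Measure Ω) (X : Ω → α) : ℝ :=
  - ∑ a, pmf μ X a * Real.logb 2 (pmf μ X a)

/-- Conditional entropy `H(X | Y) = H(X, Y) - H(Y)`. -/
def condEntropy {Ω α β : Type*} [MeasurableSpace Ω] [Fintype α] [Fintype β] (μ : Measure Ω)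
    (X : Ω → α) (Y : Ω → β) : ℝ :=
  entropy μ (fun ω => (X ω, Y ω)) - entropy μ Y

/-- Mutual information `I(X; Y) = H(X) - H(X | Y)`, in bits. -/
def mutualInfo {Ω α β : Type*} [MeasurableSpace Ω] [Fintype α] [Fintype β] (μ : Measure Ω)
    (X : Ω → α) (Y : Ω → β) : ℝ :=
  entropy μ X - condEntropy μ X Y

/-- Conditional mutual information `I(X; Y | Z) = H(X | Z) - H(X | Y, Z)`, in bits. -/
def condMutualInfo {Ω α β γ : Type*} [MeasurableSpace Ω] [Fintype α] [Fintype β] [Fintype γ]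
    (μ : Measure Ω) (X : Ω → α) (Y : Ω → β) (Z : Ω → γ) : ℝ :=
  condEntropy μ X Z - condEntropy μ X (fun ω => (Y ω, Z ω))

/-- The Markov chain `X ↔ Y ↔ Z`: `P(x, y, z) P(y) = P(x, y) P(y, z)`. -/
def MarkovChain {Ω α β γ : Type*} [MeasurableSpace Ω] (μ : Measure Ω)
    (X : Ω → α) (Y : Ω → β) (Z : Ω → γ) : Prop :=
  ∀ x y z, pmf μ (fun ω => (X ω, Y ω, Z ω)) (x, y, z) * pmf μ Y y =
    pmf μ (fun ω => (X ω, Y ω)) (x, y) * pmf μ (fun ω => (Y ω, Z ω)) (y, z)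

/-- The Markov chain `A ↔ X ↔ Y ↔ B`: the past and the future are conditionally independent
given the present, at each of the two inner variables. -/
def MarkovChain₄ {Ω α β γ κ : Type*} [MeasurableSpace Ω] (μ : Measure Ω)
    (A : Ω → α) (X : Ω → β) (Y : Ω → γ) (B : Ω → κ) : Prop :=
  MarkovChain μ A X (fun ω => (Y ω, B ω)) ∧ MarkovChain μ (fun ω => (A ω, X ω)) Y B

open Classical in
/-- The number of occurrences of the letter `a` in the sequence `s`. -/
def occurrences {α : Type*} {n : ℕ} (s : Fin n → α) (a : α) : ℕ :=
  (Finset.univ.filter (fun t => s t = a)).card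

/-- Strong `ε`-typicality of `s` for the mass function `p`: every letter has relative frequency
within `ε p(a)` of `p(a)` (so letters of probability zero do not occur). Joint typicality of
several sequences is typicality of the sequence of tuples for the joint mass function. -/
def StronglyTypical {α : Type*} {n : ℕ} (ε : ℝ) (p : α → ℝ) (s : Fin n → α) : Prop :=
  ∀ a, |(occurrences s a : ℝ) / n - p a| ≤ ε * p a

/-- The number of codewords of a codebook of rate `R` and block length `n`:
`2 ^ (n R)`, rounded down. -/
def codebookSize (n : ℕ) (R : ℝ) : ℕ := ⌊(2 : ℝ) ^ ((n : ℝ) * R)⌋₊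

/-- A superposition codebook: codewords `u i`, and for each `i` two families of codewords
`v₁ i j` and `v₂ i k`, all of length `n`. -/
abbrev Codebook (n M M₁ M₂ : ℕ) (𝒰 𝒱₁ 𝒱₂ : Type*) :=
  (Fin M → Fin n → 𝒰) × (Fin M → Fin M₁ → Fin n → 𝒱₁) × (Fin M → Fin M₂ → Fin n → 𝒱₂)

/-- The probability that random generation produces the codebook `c`: the `u i` are independent
with i.i.d. letters of law `P(U)`; given these, the `v₁ i j` and `v₂ i k` are independent, with
letters drawn independently from `P(V₁ | U = u i t)` and `P(V₂ | U = u i t)`. -/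
def codebookProb {Ω 𝒰 𝒱₁ 𝒱₂ : Type*} [MeasurableSpace Ω] (μ : Measure Ω)
    (U : Ω → 𝒰) (V₁ : Ω → 𝒱₁) (V₂ : Ω → 𝒱₂) {n M M₁ M₂ : ℕ}
    (c : Codebook n M M₁ M₂ 𝒰 𝒱₁ 𝒱₂) : ℝ :=
  ∏ i, ((∏ t, pmf μ U (c.1 i t)) *
    (∏ j, ∏ t, condPmf μ V₁ U (c.2.1 i j t) (c.1 i t)) *
    (∏ k, ∏ t, condPmf μ V₂ U (c.2.2 i k t) (c.1 i t)))

/-- The three functions `U*(xⁿ)`, `V₁*(xⁿ, U*)` and `V₂*(xⁿ, U*)` of an encoder observing `xⁿ`. -/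
structure Encoder (n : ℕ) (𝒳 𝒰 𝒱₁ 𝒱₂ : Type*) where
  u : (Fin n → 𝒳) → (Fin n → 𝒰)
  v₁ : (Fin n → 𝒳) → (Fin n → 𝒰) → (Fin n → 𝒱₁)
  v₂ : (Fin n → 𝒳) → (Fin n → 𝒰) → (Fin n → 𝒱₂)

/-- The encoder always picks codewords of the codebook `c`, with `V₁*` and `V₂*` from the two
families that belong to the chosen codeword `U* = u i`. -/
def Encoder.SelectsFrom {n M M₁ M₂ : ℕ} {𝒳 𝒰 𝒱₁ 𝒱₂ : Type*} (e : Encoder n 𝒳 𝒰 𝒱₁ 𝒱₂)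
    (c : Codebook n M M₁ M₂ 𝒰 𝒱₁ 𝒱₂) : Prop :=
  ∀ x, ∃ i j k, e.u x = c.1 i ∧ e.v₁ x (e.u x) = c.2.1 i j ∧ e.v₂ x (e.u x) = c.2.2 i k

open Classical in
/-- The probability, over the i.i.d. source pairs `(X₁ⁿ, X₂ⁿ)` and the two random codebooks (the
source sequences and the two codebooks being independent), that
`(X₁ⁿ, X₂ⁿ, U₁*, U₂*, U₁₁*, U₁₂*, U₂₁*, U₂₂*)` is jointly `ε`-typical when each encoder applies
its functions, which may depend on its own codebook. -/
def successProb {Ω 𝒳₁ 𝒳₂ 𝒰₁ 𝒰₂ 𝒰₁₁ 𝒰₁₂ 𝒰₂₁ 𝒰₂₂ : Type*} [MeasurableSpace Ω]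
    [Fintype 𝒳₁] [Fintype 𝒳₂] [Fintype 𝒰₁] [Fintype 𝒰₂]
    [Fintype 𝒰₁₁] [Fintype 𝒰₁₂] [Fintype 𝒰₂₁] [Fintype 𝒰₂₂]
    (μ : Measure Ω) (X₁ : Ω → 𝒳₁) (X₂ : Ω → 𝒳₂) (U₁ : Ω → 𝒰₁) (U₂ : Ω → 𝒰₂)
    (U₁₁ : Ω → 𝒰₁₁) (U₁₂ : Ω → 𝒰₁₂) (U₂₁ : Ω → 𝒰₂₁) (U₂₂ : Ω → 𝒰₂₂)
    {n M₁ M₁₁ M₁₂ M₂ M₂₁ M₂₂ : ℕ} (ε : ℝ)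
    (e₁ : Codebook n M₁ M₁₁ M₁₂ 𝒰₁ 𝒰₁₁ 𝒰₁₂ → Encoder n 𝒳₁ 𝒰₁ 𝒰₁₁ 𝒰₁₂)
    (e₂ : Codebook n M₂ M₂₁ M₂₂ 𝒰₂ 𝒰₂₁ 𝒰₂₂ → Encoder n 𝒳₂ 𝒰₂ 𝒰₂₁ 𝒰₂₂) : ℝ :=
  ∑ c₁ : Codebook n M₁ M₁₁ M₁₂ 𝒰₁ 𝒰₁₁ 𝒰₁₂, ∑ c₂ : Codebook n M₂ M₂₁ M₂₂ 𝒰₂ 𝒰₂₁ 𝒰₂₂,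
    ∑ x₁ : Fin n → 𝒳₁, ∑ x₂ : Fin n → 𝒳₂,
      if StronglyTypical ε
          (pmf μ fun ω => (X₁ ω, X₂ ω, U₁ ω, U₂ ω, U₁₁ ω, U₁₂ ω, U₂₁ ω, U₂₂ ω))
          (fun t => (x₁ t, x₂ t, (e₁ c₁).u x₁ t, (e₂ c₂).u x₂ t,
            (e₁ c₁).v₁ x₁ ((e₁ c₁).u x₁) t, (e₁ c₁).v₂ x₁ ((e₁ c₁).u x₁) t,
            (e₂ c₂).v₁ x₂ ((e₂ c₂).u x₂) t, (e₂ c₂).v₂ x₂ ((e₂ c₂).u x₂) t))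
      then codebookProb μ U₁ U₁₁ U₁₂ c₁ * codebookProb μ U₂ U₂₁ U₂₂ c₂ *
          ∏ t, pmf μ (fun ω => (X₁ ω, X₂ ω)) (x₁ t, x₂ t)
      else 0

end MutualCovering

end

open MutualCovering

open MeasureTheory Filter Topology

noncomputable section

namespace MutualCovering

/-! Each terminal selects from its own source block and codebook alone, so the selected tuples of
the two terminals do not follow the joint law of the problem. The proof bypasses this by a change of
measure with subexponential cost. For a source block `x`, pick uniformly an index triple whose
codewords are weakly typical with `x`. Averaged over the codebook, the law of the selected triple is
dominated, up to an exponentially small additive error, by `4 * 2^(2γn)` times the memoryless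
conditional law given `x` (`exists_selection`, and in block form
`eventually_exists_block_selection`).

Domination rests on a second moment computation. The number `S` of typical triples in the codebook
has mean `mπ`. If `S` exceeds half its mean, each typical triple is chosen with probability at most
`2/(mπ)`, and weak typicality bounds the likelihood ratio between independent codewords and the
conditional law within `2^(±γn)`. Otherwise Chebyshev applies. Triples from different clusters are
independent, and those from one cluster share the cluster index only, one satellite index as well,
or both. These four cases are beaten by the four rate conditions of a terminal, because the relevant
information quantities are means of log-likelihood ratios (`mutualInfo_eq_mean_density`,
`mean_density₀`).

The codebooks are independent, so the two dominations compose: apart from small errors, the failure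
probability is at most `16 * 2^(4γn)` times the probability that tuples from the true law are not
strongly typical. The Markov condition enters here, since it makes the source law times the two
conditional laws equal to the joint law (`MarkovChain₄.pmf_eq`). By Chernoff the atypical
probability is at most a constant times `2^(-cn)`, and `γ` is taken small against `c` and against
the rate margin `Δ` (`eventually_exists_choices`). Finally the failure probability is affine in the
randomization of each terminal, so deterministic selections do no worse (`exists_deterministic_le`).
-/

/-- The mean of `f` under the mass function `p`. -/
def mean {α : Type*} [Fintype α] (p f : α → ℝ) : ℝ := ∑ a, p a * f a

/-- The product mass function of independent letters of law `p`. -/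
def iidLaw {ι α : Type*} [Fintype ι] (p : α → ℝ) (s : ι → α) : ℝ := ∏ i, p (s i)

/-! ### First and second moments of i.i.d. sums. -/

section Moments

variable {ι α : Type*} [Fintype ι] [DecidableEq ι] [Fintype α]

lemma sum_prod_pi (f : ι → α → ℝ) : ∑ s : ι → α, ∏ i, f i (s i) = ∏ i, ∑ a, f i a :=
  (Fintype.prod_sum f).symm

lemma iidLaw_nonneg {ι α : Type*} [Fintype ι] {p : α → ℝ} (hp : ∀ a, 0 ≤ p a) (s : ι → α) :
    0 ≤ iidLaw p s :=
  Finset.prod_nonneg fun _ _ => hp _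

lemma sum_iidLaw (p : α → ℝ) (hp : ∑ a, p a = 1) : ∑ s : ι → α, iidLaw p s = 1 := by
  unfold iidLaw
  rw [sum_prod_pi (fun _ => p)]
  simp [hp]

lemma mean_mono {α : Type*} [Fintype α] {p f g : α → ℝ} (hp : ∀ a, 0 ≤ p a) (h : ∀ a, f a ≤ g a) :
    mean p f ≤ mean p g :=
  Finset.sum_le_sum fun a _ => mul_le_mul_of_nonneg_left (h a) (hp a)

lemma mean_nonneg {α : Type*} [Fintype α] {p f : α → ℝ} (hp : ∀ a, 0 ≤ p a) (h : ∀ a, 0 ≤ f a) :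
    0 ≤ mean p f :=
  Finset.sum_nonneg fun a _ => mul_nonneg (hp a) (h a)

lemma mean_add {α : Type*} [Fintype α] (p f g : α → ℝ) :
    mean p (fun a => f a + g a) = mean p f + mean p g := by
  simp [mean, mul_add, Finset.sum_add_distrib]

lemma mean_const_mul {α : Type*} [Fintype α] (p f : α → ℝ) (c : ℝ) :
    mean p (fun a => c * f a) = c * mean p f := by
  simp only [mean, Finset.mul_sum]
  exact Finset.sum_congr rfl fun _ _ => by ring

lemma mean_const {α : Type*} [Fintype α] {p : α → ℝ} (hp : ∑ a, p a = 1) (c : ℝ) :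
    mean p (fun _ => c) = c := by
  simp [mean, ← Finset.sum_mul, hp]

lemma mean_finset_sum {α κ : Type*} [Fintype α] (p : α → ℝ) (s : Finset κ) (f : κ → α → ℝ) :
    mean p (fun a => ∑ k ∈ s, f k a) = ∑ k ∈ s, mean p (f k) := by
  simp only [mean, Finset.mul_sum]
  exact Finset.sum_comm

lemma mean_comm {α β : Type*} [Fintype α] [Fintype β] (p : α → ℝ) (q : β → ℝ) (f : α → β → ℝ) :
    mean p (fun a => mean q (f a)) = mean q (fun b => mean p (fun a => f a b)) := by
  simp only [mean, Finset.mul_sum]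
  rw [Finset.sum_comm]
  exact Finset.sum_congr rfl fun _ _ => Finset.sum_congr rfl fun _ _ => by ring

lemma mean_iidLaw_prod (p : α → ℝ) (F : ι → α → ℝ) :
    mean (iidLaw p) (fun s : ι → α => ∏ i, F i (s i)) = ∏ i, mean p (F i) := by
  simp only [mean, iidLaw, ← Finset.prod_mul_distrib]
  exact sum_prod_pi (fun i a => p a * F i a)

lemma mean_iidLaw_apply {p : α → ℝ} (hp : ∑ a, p a = 1) (h : α → ℝ) (i : ι) :
    mean (iidLaw p) (fun s : ι → α => h (s i)) = mean p h := by
  have := mean_iidLaw_prod p (fun l a => if l = i then h a else 1)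
  simp only [Finset.prod_ite_eq', Finset.mem_univ, if_true] at this
  rw [this, Finset.prod_eq_single i]
  · simp
  · intro b _ hb
    simp [hb, mean_const hp]
  · simp

lemma mean_iidLaw_apply₂ {p : α → ℝ} (hp : ∑ a, p a = 1) (g h : α → ℝ) {i j : ι} (hij : i ≠ j) :
    mean (iidLaw p) (fun s : ι → α => g (s i) * h (s j)) = mean p g * mean p h := by
  have := mean_iidLaw_prod p
    (fun l a => (if l = i then g a else 1) * (if l = j then h a else 1))
  simp only [Finset.prod_mul_distrib, Finset.prod_ite_eq', Finset.mem_univ, if_true] at this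
  rw [this, ← Finset.mul_prod_erase _ _ (Finset.mem_univ i),
    ← Finset.mul_prod_erase _ _ (Finset.mem_erase.2 ⟨hij.symm, Finset.mem_univ j⟩),
    Finset.prod_eq_one]
  · simp [hij, hij.symm]
  · intro b hb
    simp only [Finset.mem_erase] at hb
    simp [hb.1, hb.2.1, mean_const hp]

lemma mean_iidLaw_sum {p : α → ℝ} (hp : ∑ a, p a = 1) (h : α → ℝ) :
    mean (iidLaw p) (fun s : ι → α => ∑ i, h (s i)) = Fintype.card ι * mean p h := by
  rw [mean_finset_sum]
  simp [mean_iidLaw_apply hp]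

/-- Expand the square: diagonal pairs contribute the second moment of a letter, and off-diagonal
pairs factor by independence. -/
lemma mean_iidLaw_sum_sq {p : α → ℝ} (hp : ∑ a, p a = 1) (h : α → ℝ) :
    mean (iidLaw p) (fun s : ι → α => (∑ i, h (s i)) ^ 2) =
      Fintype.card ι * mean p (fun a => h a ^ 2) +
        ((Fintype.card ι : ℝ) ^ 2 - Fintype.card ι) * mean p h ^ 2 := by
  have h1 : ∀ i j : ι, mean (iidLaw p) (fun s : ι → α => h (s i) * h (s j)) =
      mean p h ^ 2 + if i = j then mean p (fun a => h a ^ 2) - mean p h ^ 2 else 0 := by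
    intro i j
    split_ifs with hij
    · subst hij
      rw [mean_iidLaw_apply hp (fun a => h a * h a)]
      simp [sq]
    · rw [mean_iidLaw_apply₂ hp h h hij]
      ring
  simp only [sq (∑ i, h _), Finset.sum_mul_sum]
  rw [mean_finset_sum]
  simp only [mean_finset_sum, h1, Finset.sum_add_distrib, Finset.sum_ite_eq, Finset.mem_univ,
    if_true, Finset.sum_const, Finset.card_univ, nsmul_eq_mul]
  ring

lemma mean_iidLaw_sum_sq_le {p : α → ℝ} (hp : ∑ a, p a = 1) (h : α → ℝ) :
    mean (iidLaw p) (fun s : ι → α => (∑ i, h (s i)) ^ 2) ≤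
      Fintype.card ι * mean p (fun a => h a ^ 2) + (Fintype.card ι : ℝ) ^ 2 * mean p h ^ 2 := by
  rw [mean_iidLaw_sum_sq hp]
  have : 0 ≤ (Fintype.card ι : ℝ) * mean p h ^ 2 := by positivity
  linarith

lemma mean_iidLaw_variance_le {p : α → ℝ} (hp : ∑ a, p a = 1) (h : α → ℝ) :
    mean (iidLaw p) (fun s : ι → α => (∑ i, h (s i) - Fintype.card ι * mean p h) ^ 2) ≤
      Fintype.card ι * mean p (fun a => h a ^ 2) := by
  have h1 : ∀ s : ι → α, (∑ i, h (s i) - Fintype.card ι * mean p h) ^ 2 =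
      (∑ i, h (s i)) ^ 2 + ((-2 * (Fintype.card ι * mean p h)) * ∑ i, h (s i) +
        (Fintype.card ι * mean p h) ^ 2) := fun s => by ring
  simp only [h1]
  rw [mean_add, mean_add, mean_const_mul, mean_iidLaw_sum hp, mean_iidLaw_sum_sq hp,
    mean_const (sum_iidLaw p hp)]
  have : 0 ≤ (Fintype.card ι : ℝ) * mean p h ^ 2 := by positivity
  nlinarith

end Moments

/-! ### Exponential concentration and strong typicality. -/

section Chernoff

variable {α : Type*} [Fintype α]

open Classical in
/-- The probability of an event under a mass function. -/
def prob (p : α → ℝ) (E : α → Prop) : ℝ := mean p (fun a => if E a then 1 else 0)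

lemma prob_mono {p : α → ℝ} (hp : ∀ a, 0 ≤ p a) {E E' : α → Prop}
    (h : ∀ a, p a ≠ 0 → E a → E' a) : prob p E ≤ prob p E' := by
  refine Finset.sum_le_sum fun a _ => ?_
  by_cases h0 : p a = 0
  · simp [h0]
  · refine mul_le_mul_of_nonneg_left ?_ (hp a)
    by_cases hE : E a
    · simp [hE, h a h0 hE]
    · simp only [hE, if_false]
      split_ifs <;> norm_num

lemma prob_or_le {p : α → ℝ} (hp : ∀ a, 0 ≤ p a) (E E' : α → Prop) :
    prob p (fun a => E a ∨ E' a) ≤ prob p E + prob p E' := by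
  unfold prob
  rw [← mean_add]
  refine mean_mono hp fun a => ?_
  by_cases h1 : E a <;> by_cases h2 : E' a <;> simp [h1, h2]

lemma prob_exists_le {κ : Type*} [Fintype κ] {p : α → ℝ} (hp : ∀ a, 0 ≤ p a)
    (E : κ → α → Prop) : prob p (fun a => ∃ k, E k a) ≤ ∑ k, prob p (E k) := by
  classical
  unfold prob
  rw [← mean_finset_sum]
  refine mean_mono hp fun a => ?_
  split_ifs with h
  · obtain ⟨k, hk⟩ := h
    have := Finset.single_le_sum (f := fun k => if E k a then (1 : ℝ) else 0)
      (fun k _ => by positivity) (Finset.mem_univ k)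
    simpa [hk] using this
  · exact Finset.sum_nonneg fun k _ => by split_ifs <;> norm_num

/-- The probability that an i.i.d. sum exceeds its mean linearly decays exponentially. -/
theorem prob_iidLaw_sum_ge_le {p : α → ℝ} (hp0 : ∀ a, 0 ≤ p a) (hp1 : ∑ a, p a = 1)
    (f : α → ℝ) {η : ℝ} (hη : 0 < η) :
    ∃ c : ℝ, 0 < c ∧ ∀ n : ℕ, prob (iidLaw p) (fun s : Fin n → α => n * (mean p f + η) ≤ ∑ t, f (s t))
      ≤ (2 : ℝ) ^ (-(c * n)) := by
  set g : α → ℝ := fun a => f a - mean p f with hg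
  have hg0 : mean p g = 0 := by
    have : g = fun a => f a + -mean p f := funext fun a => sub_eq_add_neg _ _
    rw [this, mean_add, mean_const hp1]
    ring
  obtain ⟨B, hB0, hB⟩ : ∃ B : ℝ, 0 < B ∧ ∀ a, |g a| ≤ B :=
    ⟨∑ a, |g a| + 1, by positivity, fun a => by
      have := Finset.single_le_sum (f := fun a => |g a|) (fun _ _ => abs_nonneg _)
        (Finset.mem_univ a)
      linarith⟩
  -- The first bound keeps `|l * g a| ≤ 1`, where `exp y ≤ 1 + y + y ^ 2`. The second makes the
  -- quadratic term at most `l * η / 2`, half of the exponent gained from the deviation.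
  set l : ℝ := min (1 / B) (η / (2 * B ^ 2)) with hl
  have hl0 : 0 < l := by positivity
  have hlB : l * B ≤ 1 := by
    have : l ≤ 1 / B := min_le_left _ _
    rwa [le_div_iff₀ hB0] at this
  have hlη : l * B ^ 2 ≤ η / 2 := by
    have : l ≤ η / (2 * B ^ 2) := min_le_right _ _
    rw [le_div_iff₀ (by positivity)] at this
    linarith
  have hmgf : mean p (fun a => Real.exp (l * g a)) ≤ Real.exp (l * η / 2) := by
    have h1 : ∀ a, Real.exp (l * g a) ≤ 1 + (l * g a + l ^ 2 * B ^ 2) := by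
      intro a
      have habs : |l * g a| ≤ 1 := by
        rw [abs_mul, abs_of_pos hl0]
        exact (mul_le_mul_of_nonneg_left (hB a) hl0.le).trans hlB
      have h2 := abs_le.1 (Real.abs_exp_sub_one_sub_id_le habs)
      have h3 : (l * g a) ^ 2 ≤ l ^ 2 * B ^ 2 := by
        rw [mul_pow]
        exact mul_le_mul_of_nonneg_left (sq_le_sq' (abs_le.1 (hB a)).1 (abs_le.1 (hB a)).2)
          (by positivity)
      linarith [h2.2]
    refine (mean_mono hp0 h1).trans ?_
    rw [mean_add p (fun _ => (1 : ℝ)), mean_add, mean_const hp1, mean_const_mul, hg0, mean_const hp1]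
    have h4 : l ^ 2 * B ^ 2 ≤ l * η / 2 := by nlinarith
    have := Real.add_one_le_exp (l * η / 2)
    linarith
  have hlog : 0 < Real.log 2 := Real.log_pos (by norm_num)
  refine ⟨l * η / 2 / Real.log 2, by positivity, fun n => ?_⟩
  have hE : (2 : ℝ) ^ (-(l * η / 2 / Real.log 2 * n)) = Real.exp (-(l * η / 2) * n) := by
    rw [Real.rpow_def_of_pos (by norm_num)]
    congr 1
    field_simp
  rw [hE]
  have h5 : ∀ s : Fin n → α,
      (if n * (mean p f + η) ≤ ∑ t, f (s t) then (1 : ℝ) else 0) ≤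
        Real.exp (-(l * η * n)) * ∏ t, Real.exp (l * g (s t)) := by
    intro s
    rw [← Real.exp_sum, ← Real.exp_add]
    split_ifs with h
    · rw [← Finset.mul_sum]
      refine Real.one_le_exp ?_
      have : ∑ t, g (s t) = ∑ t, f (s t) - n * mean p f := by simp [hg]
      rw [this]
      nlinarith
    · positivity
  unfold prob
  refine (mean_mono (iidLaw_nonneg hp0) (fun s => by convert h5 s)).trans ?_
  rw [mean_const_mul, mean_iidLaw_prod p (fun _ a => Real.exp (l * g a))]
  simp only [Finset.prod_const, Finset.card_univ, Fintype.card_fin]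
  calc _ ≤ Real.exp (-(l * η * n)) * Real.exp (l * η / 2) ^ n := by
        refine mul_le_mul_of_nonneg_left (pow_le_pow_left₀ ?_ hmgf n) (Real.exp_nonneg _)
        exact mean_nonneg hp0 fun _ => (Real.exp_nonneg _)
    _ = _ := by
        rw [← Real.exp_nat_mul, ← Real.exp_add]
        congr 1
        ring

lemma prob_iidLaw_le_sum_le {p : α → ℝ} (hp0 : ∀ a, 0 ≤ p a) (hp1 : ∑ a, p a = 1)
    (f : α → ℝ) {η : ℝ} (hη : 0 < η) :
    ∃ c : ℝ, 0 < c ∧ ∀ n : ℕ, prob (iidLaw p) (fun s : Fin n → α => ∑ t, f (s t) ≤ n * (mean p f - η))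
      ≤ (2 : ℝ) ^ (-(c * n)) := by
  obtain ⟨c, hc, h⟩ := prob_iidLaw_sum_ge_le hp0 hp1 (fun a => -1 * f a) hη
  refine ⟨c, hc, fun n => le_trans (prob_mono (iidLaw_nonneg hp0) fun s _ hs => ?_) (h n)⟩
  rw [mean_const_mul, ← Finset.mul_sum]
  linarith

lemma tendsto_two_rpow_neg {c : ℝ} (hc : 0 < c) :
    Tendsto (fun n : ℕ => (2 : ℝ) ^ (-(c * n))) atTop (𝓝 0) := by
  have h : ∀ n : ℕ, (2 : ℝ) ^ (-(c * n)) = ((2 : ℝ) ^ (-c)) ^ n := fun n => by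
    rw [← Real.rpow_natCast, ← Real.rpow_mul (by norm_num)]
    congr 1
    ring
  simp only [h]
  exact tendsto_pow_atTop_nhds_zero_of_lt_one (by positivity)
    (Real.rpow_lt_one_of_one_lt_of_neg (by norm_num) (by linarith))

lemma sum_indicator_eq_occurrences {α : Type*} {n : ℕ} [DecidableEq α] (s : Fin n → α) (a : α) :
    ∑ t, (if s t = a then (1 : ℝ) else 0) = occurrences s a := by
  simp only [occurrences, Finset.sum_boole]
  congr!

/-- Strong typicality fails with exponentially small probability. -/
theorem prob_not_stronglyTypical_le {p : α → ℝ} (hp0 : ∀ a, 0 ≤ p a) (hp1 : ∑ a, p a = 1)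
    {ε : ℝ} (hε : 0 < ε) :
    ∃ c : ℝ, 0 < c ∧ ∃ C : ℝ, ∀ n : ℕ, 0 < n →
      prob (iidLaw p) (fun s : Fin n → α => ¬ StronglyTypical ε p s) ≤
        C * (2 : ℝ) ^ (-(c * n)) := by
  classical
  have key : ∀ a, ∃ c : ℝ, 0 < c ∧ ∀ n : ℕ, 0 < n → prob (iidLaw p) (fun s : Fin n → α =>
      ¬ |(occurrences s a : ℝ) / n - p a| ≤ ε * p a) ≤ 2 * (2 : ℝ) ^ (-(c * n)) := by
    intro a
    rcases (hp0 a).eq_or_lt with h0 | h0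
    -- For a null letter the tolerance `ε * p a` is zero, so the Chernoff bounds, which need a
    -- positive deviation, do not apply. Such a letter occurs only in sequences of probability zero.
    · refine ⟨1, one_pos, fun n _ => ?_⟩
      refine le_trans (prob_mono (E' := fun _ => False) (iidLaw_nonneg hp0) ?_) ?_
      · intro s hs hocc
        apply hocc
        have : occurrences s a = 0 := by
          rw [occurrences, Finset.card_eq_zero, Finset.filter_eq_empty_iff]
          intro t _ ht
          exact hs (Finset.prod_eq_zero (Finset.mem_univ t) (by rw [ht, ← h0]))
        simp [this, ← h0]
      · simp only [prob, if_false]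
        simp only [mean, mul_zero, Finset.sum_const_zero]
        positivity
    · set f : α → ℝ := fun b => if b = a then 1 else 0 with hf
      have hm : mean p f = p a := by simp [mean, hf]
      obtain ⟨c₁, hc₁, h₁⟩ := prob_iidLaw_sum_ge_le hp0 hp1 f (mul_pos hε h0)
      obtain ⟨c₂, hc₂, h₂⟩ := prob_iidLaw_le_sum_le hp0 hp1 f (mul_pos hε h0)
      refine ⟨min c₁ c₂, lt_min hc₁ hc₂, fun n hn => ?_⟩
      have hn' : (0 : ℝ) < n := by exact_mod_cast hn
      have hle : ∀ c, min c₁ c₂ ≤ c → (2 : ℝ) ^ (-(c * n)) ≤ (2 : ℝ) ^ (-(min c₁ c₂ * n)) :=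
        fun c hc => Real.rpow_le_rpow_of_exponent_le (by norm_num) (by nlinarith)
      have h3 := (h₁ n).trans (hle c₁ (min_le_left _ _))
      have h4 := (h₂ n).trans (hle c₂ (min_le_right _ _))
      refine (prob_mono (iidLaw_nonneg hp0) ?_).trans ((prob_or_le (iidLaw_nonneg hp0) _ _).trans
        (by rw [two_mul]; exact add_le_add h3 h4))
      intro s _ hs
      rw [hm]
      simp only [hf, sum_indicator_eq_occurrences]
      by_contra! hcon
      apply hs
      rw [abs_le]
      constructor
      · have : p a - ε * p a ≤ (occurrences s a : ℝ) / n := by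
          rw [le_div_iff₀ hn']
          linarith [hcon.2]
        linarith
      · have : (occurrences s a : ℝ) / n ≤ p a + ε * p a := by
          rw [div_le_iff₀ hn']
          linarith [hcon.1]
        linarith
  choose c hc h using key
  have hne : (Finset.univ : Finset α).Nonempty := by
    rw [Finset.univ_nonempty_iff]
    by_contra hemp
    rw [not_nonempty_iff] at hemp
    simp at hp1
  refine ⟨Finset.univ.inf' hne c, by simpa using hc, Fintype.card α * 2, fun n hn => ?_⟩
  have h1 : ∀ s : Fin n → α, ¬ StronglyTypical ε p s →
      ∃ a, ¬ |(occurrences s a : ℝ) / n - p a| ≤ ε * p a := fun s hs => by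
    simpa only [StronglyTypical, not_forall] using hs
  refine (prob_mono (iidLaw_nonneg hp0) fun s _ => h1 s).trans
    ((prob_exists_le (iidLaw_nonneg hp0) _).trans ?_)
  calc _ ≤ ∑ _a : α, 2 * (2 : ℝ) ^ (-(Finset.univ.inf' hne c * n)) := by
        refine Finset.sum_le_sum fun a _ => (h a n hn).trans ?_
        refine mul_le_mul_of_nonneg_left ?_ zero_le_two
        refine Real.rpow_le_rpow_of_exponent_le (by norm_num) ?_
        have : Finset.univ.inf' hne c ≤ c a := Finset.inf'_le _ (Finset.mem_univ a)
        have hn' : (0 : ℝ) ≤ n := by positivity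
        nlinarith
    _ = _ := by
        simp [mul_assoc]

end Chernoff

/-! ### One-shot covering with superposition codebooks. -/

section Covering

variable {A B C : Type*} [Fintype A] [Fintype B] [Fintype C] {M M₁ M₂ : ℕ}

/-- A superposition codebook with codewords in arbitrary sets. -/
abbrev Book (M M₁ M₂ : ℕ) (A B C : Type*) :=
  (Fin M → A) × (Fin M → Fin M₁ → B) × (Fin M → Fin M₂ → C)

/-- The codeword triple with the given indices. -/
def Book.word (c : Book M M₁ M₂ A B C) (i : Fin M × Fin M₁ × Fin M₂) : A × B × C :=
  (c.1 i.1, c.2.1 i.1 i.2.1, c.2.2 i.1 i.2.2)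

/-- The law of one codeword with its satellites. -/
def clusterLaw (P : A → ℝ) (q₁ : A → B → ℝ) (q₂ : A → C → ℝ)
    (r : A × (Fin M₁ → B) × (Fin M₂ → C)) : ℝ :=
  P r.1 * (iidLaw (q₁ r.1) r.2.1 * iidLaw (q₂ r.1) r.2.2)

/-- The law of a random superposition codebook. -/
def bookLaw (P : A → ℝ) (q₁ : A → B → ℝ) (q₂ : A → C → ℝ) (c : Book M M₁ M₂ A B C) : ℝ :=
  ∏ i, clusterLaw P q₁ q₂ (c.1 i, c.2.1 i, c.2.2 i)

/-- A codebook is a family of clusters. -/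
def bookEquiv (M M₁ M₂ : ℕ) (A B C : Type*) :
    Book M M₁ M₂ A B C ≃ (Fin M → A × (Fin M₁ → B) × (Fin M₂ → C)) where
  toFun c i := (c.1 i, c.2.1 i, c.2.2 i)
  invFun r := (fun i => (r i).1, fun i => (r i).2.1, fun i => (r i).2.2)
  left_inv _ := rfl
  right_inv _ := rfl

/-- The law of a triple made of a codeword and one satellite of each family. -/
def tripleLaw (P : A → ℝ) (q₁ : A → B → ℝ) (q₂ : A → C → ℝ) (z : A × B × C) : ℝ :=
  P z.1 * (q₁ z.1 z.2.1 * q₂ z.1 z.2.2)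

lemma mean_prod {α β : Type*} [Fintype α] [Fintype β] (P : α → ℝ) (Q : α → β → ℝ)
    (f : α × β → ℝ) :
    mean (fun z : α × β => P z.1 * Q z.1 z.2) f =
      mean P (fun a => mean (Q a) (fun b => f (a, b))) := by
  simp only [mean, Fintype.sum_prod_type, Finset.mul_sum, mul_assoc]

lemma mean_tripleLaw (P : A → ℝ) (q₁ : A → B → ℝ) (q₂ : A → C → ℝ) (f : A × B × C → ℝ) :
    mean (tripleLaw P q₁ q₂) f =
      mean P (fun a => mean (q₁ a) fun b => mean (q₂ a) fun c => f (a, b, c)) := by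
  simp only [mean, tripleLaw, Fintype.sum_prod_type, Finset.mul_sum, mul_assoc]

/-- A cluster is itself a triple whose two satellites are whole i.i.d. families. -/
lemma mean_clusterLaw (P : A → ℝ) (q₁ : A → B → ℝ) (q₂ : A → C → ℝ)
    (f : A × (Fin M₁ → B) × (Fin M₂ → C) → ℝ) :
    mean (clusterLaw P q₁ q₂) f =
      mean P (fun a => mean (iidLaw (q₁ a)) fun b => mean (iidLaw (q₂ a)) fun c => f (a, b, c)) :=
  mean_tripleLaw P (fun a => iidLaw (q₁ a)) (fun a => iidLaw (q₂ a)) f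

lemma mean_bookLaw (P : A → ℝ) (q₁ : A → B → ℝ) (q₂ : A → C → ℝ)
    (f : (Fin M → A × (Fin M₁ → B) × (Fin M₂ → C)) → ℝ) :
    mean (bookLaw P q₁ q₂) (fun c : Book M M₁ M₂ A B C => f (bookEquiv M M₁ M₂ A B C c)) =
      mean (iidLaw (clusterLaw P q₁ q₂)) f :=
  (bookEquiv M M₁ M₂ A B C).sum_comp (fun r => iidLaw (clusterLaw P q₁ q₂) r * f r)

variable {P : A → ℝ} {q₁ : A → B → ℝ} {q₂ : A → C → ℝ}

lemma sum_eq_mean_one {α : Type*} [Fintype α] (p : α → ℝ) : ∑ a, p a = mean p fun _ => 1 := by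
  simp [mean]

lemma sum_clusterLaw (hP : ∑ a, P a = 1) (h₁ : ∀ a, ∑ b, q₁ a b = 1)
    (h₂ : ∀ a, ∑ c, q₂ a c = 1) :
    ∑ r : A × (Fin M₁ → B) × (Fin M₂ → C), clusterLaw P q₁ q₂ r = 1 := by
  rw [sum_eq_mean_one, mean_clusterLaw]
  simp only [mean_const (sum_iidLaw _ (h₁ _)), mean_const (sum_iidLaw _ (h₂ _)), mean_const hP]

lemma clusterLaw_nonneg {A B C : Type*} {P : A → ℝ} {q₁ : A → B → ℝ} {q₂ : A → C → ℝ}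
    (hP : ∀ a, 0 ≤ P a) (h₁ : ∀ a b, 0 ≤ q₁ a b) (h₂ : ∀ a c, 0 ≤ q₂ a c)
    (r : A × (Fin M₁ → B) × (Fin M₂ → C)) : 0 ≤ clusterLaw P q₁ q₂ r :=
  mul_nonneg (hP _) (mul_nonneg (iidLaw_nonneg (h₁ _) _) (iidLaw_nonneg (h₂ _) _))

lemma bookLaw_nonneg {A B C : Type*} {P : A → ℝ} {q₁ : A → B → ℝ} {q₂ : A → C → ℝ}
    (hP : ∀ a, 0 ≤ P a) (h₁ : ∀ a b, 0 ≤ q₁ a b) (h₂ : ∀ a c, 0 ≤ q₂ a c)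
    (c : Book M M₁ M₂ A B C) : 0 ≤ bookLaw P q₁ q₂ c :=
  Finset.prod_nonneg fun _ _ => clusterLaw_nonneg hP h₁ h₂ _

lemma sum_bookLaw (hP : ∑ a, P a = 1) (h₁ : ∀ a, ∑ b, q₁ a b = 1) (h₂ : ∀ a, ∑ c, q₂ a c = 1) :
    ∑ c : Book M M₁ M₂ A B C, bookLaw P q₁ q₂ c = 1 := by
  rw [sum_eq_mean_one, mean_bookLaw P q₁ q₂ (fun _ => 1),
    mean_const (sum_iidLaw _ (sum_clusterLaw hP h₁ h₂))]

/-- The sum of `g` over the triples of a cluster. -/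
def clusterSum (g : A × B × C → ℝ) (r : A × (Fin M₁ → B) × (Fin M₂ → C)) : ℝ :=
  ∑ j, ∑ k, g (r.1, r.2.1 j, r.2.2 k)

lemma sum_word {A B C : Type*} (g : A × B × C → ℝ) (c : Book M M₁ M₂ A B C) :
    ∑ i, g (c.word i) = ∑ i, clusterSum g (bookEquiv M M₁ M₂ A B C c i) := by
  simp only [Fintype.sum_prod_type, Book.word, clusterSum, bookEquiv, Equiv.coe_fn_mk]

lemma mean_clusterSum (h₁ : ∀ a, ∑ b, q₁ a b = 1) (h₂ : ∀ a, ∑ c, q₂ a c = 1)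
    (g : A × B × C → ℝ) :
    mean (clusterLaw P q₁ q₂) (clusterSum (M₁ := M₁) (M₂ := M₂) g) =
      M₁ * M₂ * mean (tripleLaw P q₁ q₂) g := by
  rw [mean_clusterLaw, mean_tripleLaw, ← mean_const_mul]
  congr 1
  funext a
  have e1 : ∀ b : Fin M₁ → B,
      mean (iidLaw (q₂ a)) (fun c : Fin M₂ → C => clusterSum g (a, b, c)) =
        ∑ j, M₂ * mean (q₂ a) (fun c => g (a, b j, c)) := by
    intro b
    simp only [clusterSum, mean_finset_sum]
    refine Finset.sum_congr rfl fun j _ => ?_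
    have := mean_iidLaw_sum (ι := Fin M₂) (h₂ a) (fun c => g (a, b j, c))
    rwa [mean_finset_sum, Fintype.card_fin] at this
  simp only [e1]
  rw [mean_iidLaw_sum (ι := Fin M₁) (h₁ a) (fun b => M₂ * mean (q₂ a) fun c => g (a, b, c)),
    mean_const_mul, Fintype.card_fin]
  ring

lemma mean_sum_word (hP : ∑ a, P a = 1) (h₁ : ∀ a, ∑ b, q₁ a b = 1)
    (h₂ : ∀ a, ∑ c, q₂ a c = 1) (g : A × B × C → ℝ) :
    mean (bookLaw P q₁ q₂) (fun c : Book M M₁ M₂ A B C => ∑ i, g (c.word i)) =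
      M * (M₁ * M₂ * mean (tripleLaw P q₁ q₂) g) := by
  simp only [sum_word]
  rw [mean_bookLaw P q₁ q₂ (fun r => ∑ i, clusterSum g (r i)),
    mean_iidLaw_sum (sum_clusterLaw hP h₁ h₂), mean_clusterSum h₁ h₂, Fintype.card_fin]

/-- Second moment of the number of triples of a cluster, before averaging over the codeword. -/
lemma mean_clusterSum_sq_le (hP0 : ∀ a, 0 ≤ P a) (h10 : ∀ a b, 0 ≤ q₁ a b)
    (h20 : ∀ a c, 0 ≤ q₂ a c) (h₁ : ∀ a, ∑ b, q₁ a b = 1) (h₂ : ∀ a, ∑ c, q₂ a c = 1)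
    (g : A × B × C → ℝ) :
    mean (clusterLaw P q₁ q₂) (fun r : A × (Fin M₁ → B) × (Fin M₂ → C) => clusterSum g r ^ 2) ≤
      mean P fun a =>
        (M₁ : ℝ) ^ 2 * (M₂ : ℝ) ^ 2 *
          (mean (q₁ a) fun b => mean (q₂ a) fun c => g (a, b, c)) ^ 2 +
        (M₁ : ℝ) ^ 2 * M₂ * (mean (q₂ a) fun c => (mean (q₁ a) fun b => g (a, b, c)) ^ 2) +
        M₁ * (M₂ : ℝ) ^ 2 * (mean (q₁ a) fun b => (mean (q₂ a) fun c => g (a, b, c)) ^ 2) +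
        M₁ * M₂ * (mean (q₁ a) fun b => mean (q₂ a) fun c => g (a, b, c) ^ 2) := by
  rw [mean_clusterLaw]
  refine mean_mono hP0 fun a => ?_
  rw [mean_comm]
  -- Average over the first family with the second fixed, then over the second. Each average splits
  -- into a diagonal and an off-diagonal part, which gives the four terms.
  have e1 : ∀ c : Fin M₂ → C,
      mean (iidLaw (q₁ a)) (fun b : Fin M₁ → B => clusterSum g (a, b, c) ^ 2) ≤
        M₁ * (mean (q₁ a) fun b => (∑ k, g (a, b, c k)) ^ 2) +
          (M₁ : ℝ) ^ 2 * (∑ k, mean (q₁ a) fun b => g (a, b, c k)) ^ 2 := by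
    intro c
    have := mean_iidLaw_sum_sq_le (ι := Fin M₁) (h₁ a) (fun b => ∑ k, g (a, b, c k))
    rwa [Fintype.card_fin, mean_finset_sum] at this
  have e2 : ∀ b : B,
      mean (iidLaw (q₂ a)) (fun c : Fin M₂ → C => (∑ k, g (a, b, c k)) ^ 2) ≤
        M₂ * (mean (q₂ a) fun c => g (a, b, c) ^ 2) +
          (M₂ : ℝ) ^ 2 * (mean (q₂ a) fun c => g (a, b, c)) ^ 2 := by
    intro b
    have := mean_iidLaw_sum_sq_le (ι := Fin M₂) (h₂ a) (fun c => g (a, b, c))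
    rwa [Fintype.card_fin] at this
  have e3 := mean_iidLaw_sum_sq_le (ι := Fin M₂) (h₂ a) (fun c => mean (q₁ a) fun b => g (a, b, c))
  rw [Fintype.card_fin, mean_comm (q₂ a)] at e3
  refine (mean_mono (iidLaw_nonneg (h20 a)) e1).trans ?_
  rw [mean_add, mean_const_mul, mean_const_mul, mean_comm]
  have e4 := mean_mono (h10 a) e2
  rw [mean_add, mean_const_mul, mean_const_mul] at e4
  have e5 := mul_le_mul_of_nonneg_left e4 (Nat.cast_nonneg (α := ℝ) M₁)
  have e6 := mul_le_mul_of_nonneg_left e3 (sq_nonneg (M₁ : ℝ))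
  linarith

/-- One of the two factors of the square is replaced by the bound `k`. The hypothesis is weighted by
`p`, so it asks for no bound on null points. -/
lemma mean_sq_le_mul {α : Type*} [Fintype α] {p t : α → ℝ} {k : ℝ} (ht : ∀ a, 0 ≤ t a)
    (h : ∀ a, p a * t a ≤ k * p a) : mean p (fun a => t a ^ 2) ≤ k * mean p t := by
  rw [← mean_const_mul]
  refine Finset.sum_le_sum fun a _ => ?_
  have := mul_le_mul_of_nonneg_right (h a) (ht a)
  linarith

lemma mean_le_one {α : Type*} [Fintype α] {p f : α → ℝ} (hp0 : ∀ a, 0 ≤ p a)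
    (hp1 : ∑ a, p a = 1) (hf : ∀ a, f a ≤ 1) : mean p f ≤ 1 :=
  (mean_mono hp0 hf).trans_eq (mean_const hp1 1)

open Classical in
/-- Second moment of the number of covering triples of a cluster. -/
lemma mean_clusterSum_indicator_sq_le (hP0 : ∀ a, 0 ≤ P a) (h10 : ∀ a b, 0 ≤ q₁ a b)
    (h20 : ∀ a c, 0 ≤ q₂ a c) (h₁ : ∀ a, ∑ b, q₁ a b = 1) (h₂ : ∀ a, ∑ c, q₂ a c = 1)
    {T : Set (A × B × C)} {w : A × B × C → ℝ} (hw : ∀ z, 0 ≤ w z) {lo k₀ k₁ k₂ : ℝ}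
    (hlo : 0 < lo) (hk₀ : 0 ≤ k₀) (hk₁ : 0 ≤ k₁) (hk₂ : 0 ≤ k₂)
    (hT : ∀ z ∈ T, lo * tripleLaw P q₁ q₂ z ≤ w z)
    (hT₀ : ∀ a b c, (a, b, c) ∈ T → ∑ b', ∑ c', w (a, b', c') ≤ k₀ * P a)
    (hT₁ : ∀ a b c, (a, b, c) ∈ T → ∑ c', w (a, b, c') ≤ k₁ * (P a * q₁ a b))
    (hT₂ : ∀ a b c, (a, b, c) ∈ T → ∑ b', w (a, b', c) ≤ k₂ * (P a * q₂ a c)) :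
    mean (clusterLaw P q₁ q₂) (fun r : A × (Fin M₁ → B) × (Fin M₂ → C) =>
        clusterSum (fun z => if z ∈ T then 1 else 0) r ^ 2) ≤
      ((M₁ : ℝ) ^ 2 * (M₂ : ℝ) ^ 2 * (k₀ / lo) + (M₁ : ℝ) ^ 2 * M₂ * (k₂ / lo) +
        M₁ * (M₂ : ℝ) ^ 2 * (k₁ / lo) + M₁ * M₂) *
        mean (tripleLaw P q₁ q₂) (fun z => if z ∈ T then 1 else 0) := by
  set g : A × B × C → ℝ := fun z => if z ∈ T then 1 else 0 with hg
  have hg0 : ∀ z, 0 ≤ g z := fun z => by simp only [hg]; positivity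
  -- On `T` the law of independent codewords is at most `w / lo`, so its partial sums are controlled
  -- by the partial sums of `w` in `hT₀`, `hT₁`, `hT₂`.
  have hgw : ∀ z, tripleLaw P q₁ q₂ z * g z ≤ w z / lo := by
    intro z
    simp only [hg]
    split_ifs with hz
    · rw [le_div_iff₀ hlo, mul_one, mul_comm]
      exact hT z hz
    · simpa using div_nonneg (hw z) hlo.le
  set t₀ : A → ℝ := fun a => mean (q₁ a) fun b => mean (q₂ a) fun c => g (a, b, c) with ht₀
  set t₁ : A → B → ℝ := fun a b => mean (q₂ a) fun c => g (a, b, c) with ht₁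
  set t₂ : A → C → ℝ := fun a c => mean (q₁ a) fun b => g (a, b, c) with ht₂
  have t₁0 : ∀ a b, 0 ≤ t₁ a b := fun a b => mean_nonneg (h20 a) fun c => hg0 _
  have t₂0 : ∀ a c, 0 ≤ t₂ a c := fun a b => mean_nonneg (h10 a) fun c => hg0 _
  have t₀0 : ∀ a, 0 ≤ t₀ a := fun a => mean_nonneg (h10 a) fun b => t₁0 a b
  have hπ : mean (tripleLaw P q₁ q₂) g = mean P t₀ := mean_tripleLaw _ _ _ _
  have hsum₁ : ∀ a b, P a * q₁ a b * t₁ a b = ∑ c, tripleLaw P q₁ q₂ (a, b, c) * g (a, b, c) := by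
    intro a b
    simp only [ht₁, mean, tripleLaw, Finset.mul_sum, mul_assoc]
  have hsum₂ : ∀ a c, P a * q₂ a c * t₂ a c = ∑ b, tripleLaw P q₁ q₂ (a, b, c) * g (a, b, c) := by
    intro a c
    simp only [ht₂, mean, tripleLaw, Finset.mul_sum]
    exact Finset.sum_congr rfl fun _ _ => by ring
  have hsum₀ : ∀ a, P a * t₀ a = ∑ b, ∑ c, tripleLaw P q₁ q₂ (a, b, c) * g (a, b, c) := by
    intro a
    simp only [ht₀, mean, tripleLaw, Finset.mul_sum, mul_assoc]
  -- The hypotheses bound partial sums of `w` only where the fixed coordinates extend to a point of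
  -- `T`. Elsewhere the sum of `g` vanishes. The same split gives `b₁` and `b₂`.
  have b₀ : ∀ a, P a * t₀ a ≤ k₀ / lo * P a := by
    intro a
    rw [hsum₀]
    by_cases hex : ∃ b c, (a, b, c) ∈ T
    · obtain ⟨b, c, hbc⟩ := hex
      calc _ ≤ ∑ b, ∑ c, w (a, b, c) / lo :=
            Finset.sum_le_sum fun _ _ => Finset.sum_le_sum fun _ _ => hgw _
        _ = (∑ b, ∑ c, w (a, b, c)) / lo := by simp only [Finset.sum_div]
        _ ≤ k₀ * P a / lo := by gcongr; exact hT₀ a b c hbc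
        _ = _ := by ring
    · push Not at hex
      rw [Finset.sum_eq_zero fun b _ => Finset.sum_eq_zero fun c _ => by simp [hg, hex b c]]
      have := hP0 a
      positivity
  have b₁ : ∀ a b, P a * q₁ a b * t₁ a b ≤ k₁ / lo * (P a * q₁ a b) := by
    intro a b
    rw [hsum₁]
    by_cases hex : ∃ c, (a, b, c) ∈ T
    · obtain ⟨c, hbc⟩ := hex
      calc _ ≤ ∑ c, w (a, b, c) / lo := Finset.sum_le_sum fun _ _ => hgw _
        _ = (∑ c, w (a, b, c)) / lo := by simp only [Finset.sum_div]
        _ ≤ k₁ * (P a * q₁ a b) / lo := by gcongr; exact hT₁ a b c hbc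
        _ = _ := by ring
    · push Not at hex
      rw [Finset.sum_eq_zero fun c _ => by simp [hg, hex c]]
      have := hP0 a
      have := h10 a b
      positivity
  have b₂ : ∀ a c, P a * q₂ a c * t₂ a c ≤ k₂ / lo * (P a * q₂ a c) := by
    intro a c
    rw [hsum₂]
    by_cases hex : ∃ b, (a, b, c) ∈ T
    · obtain ⟨b, hbc⟩ := hex
      calc _ ≤ ∑ b, w (a, b, c) / lo := Finset.sum_le_sum fun _ _ => hgw _
        _ = (∑ b, w (a, b, c)) / lo := by simp only [Finset.sum_div]
        _ ≤ k₂ * (P a * q₂ a c) / lo := by gcongr; exact hT₂ a b c hbc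
        _ = _ := by ring
    · push Not at hex
      rw [Finset.sum_eq_zero fun b _ => by simp [hg, hex b]]
      have := hP0 a
      have := h20 a c
      positivity
  have m₀ : mean P (fun a => t₀ a ^ 2) ≤ k₀ / lo * mean P t₀ := mean_sq_le_mul t₀0 b₀
  have m₁ : mean P (fun a => mean (q₁ a) fun b => t₁ a b ^ 2) ≤ k₁ / lo * mean P t₀ := by
    have := mean_sq_le_mul (p := fun z : A × B => P z.1 * q₁ z.1 z.2)
      (t := fun z => t₁ z.1 z.2) (k := k₁ / lo) (fun z => t₁0 _ _) (fun z => b₁ _ _)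
    rwa [mean_prod, mean_prod] at this
  have m₂ : mean P (fun a => mean (q₂ a) fun c => t₂ a c ^ 2) ≤ k₂ / lo * mean P t₀ := by
    have := mean_sq_le_mul (p := fun z : A × C => P z.1 * q₂ z.1 z.2)
      (t := fun z => t₂ z.1 z.2) (k := k₂ / lo) (fun z => t₂0 _ _) (fun z => b₂ _ _)
    rw [mean_prod, mean_prod] at this
    have e : (fun a => mean (q₂ a) fun c => t₂ a c) = t₀ := funext fun a => mean_comm _ _ _
    simp only [e] at this
    exact this
  have m₃ : mean P (fun a => mean (q₁ a) fun b => mean (q₂ a) fun c => g (a, b, c) ^ 2) =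
      mean P t₀ := by
    have : ∀ z, g z ^ 2 = g z := fun z => by simp only [hg]; split_ifs <;> norm_num
    simp only [this]
    rfl
  refine (mean_clusterSum_sq_le hP0 h10 h20 h₁ h₂ g).trans ?_
  rw [mean_add, mean_add, mean_add, mean_const_mul, mean_const_mul, mean_const_mul,
    mean_const_mul, hπ, m₃]
  have n₀ := mul_le_mul_of_nonneg_left m₀
    (mul_nonneg (sq_nonneg (M₁ : ℝ)) (sq_nonneg (M₂ : ℝ)))
  have n₁ := mul_le_mul_of_nonneg_left m₁
    (mul_nonneg (Nat.cast_nonneg (α := ℝ) M₁) (sq_nonneg (M₂ : ℝ)))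
  have n₂ := mul_le_mul_of_nonneg_left m₂
    (mul_nonneg (sq_nonneg (M₁ : ℝ)) (Nat.cast_nonneg (α := ℝ) M₂))
  linarith

open Classical in
/-- One-shot mutual covering: a random choice among the triples of codewords in `T` has a law
dominated by `w`, up to the probability that there are too few of them. -/
theorem exists_selection (hM : 0 < M) (hM₁ : 0 < M₁) (hM₂ : 0 < M₂)
    (hP0 : ∀ a, 0 ≤ P a) (h10 : ∀ a b, 0 ≤ q₁ a b)
    (h20 : ∀ a c, 0 ≤ q₂ a c) (hP : ∑ a, P a = 1) (h₁ : ∀ a, ∑ b, q₁ a b = 1)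
    (h₂ : ∀ a, ∑ c, q₂ a c = 1)
    {T : Set (A × B × C)} {w : A × B × C → ℝ} (hw : ∀ z, 0 ≤ w z) {lo hi k₀ k₁ k₂ : ℝ}
    (hlo : 0 < lo) (hhi : 0 < hi) (hk₀ : 0 ≤ k₀) (hk₁ : 0 ≤ k₁) (hk₂ : 0 ≤ k₂)
    (hwT : 1 / 2 ≤ mean w (fun z => if z ∈ T then 1 else 0))
    (hT : ∀ z ∈ T, lo * tripleLaw P q₁ q₂ z ≤ w z)
    (hT' : ∀ z ∈ T, w z ≤ hi * tripleLaw P q₁ q₂ z)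
    (hT₀ : ∀ a b c, (a, b, c) ∈ T → ∑ b', ∑ c', w (a, b', c') ≤ k₀ * P a)
    (hT₁ : ∀ a b c, (a, b, c) ∈ T → ∑ c', w (a, b, c') ≤ k₁ * (P a * q₁ a b))
    (hT₂ : ∀ a b c, (a, b, c) ∈ T → ∑ b', w (a, b', c) ≤ k₂ * (P a * q₂ a c)) :
    ∃ K : Book M M₁ M₂ A B C → Fin M × Fin M₁ × Fin M₂ → ℝ,
      (∀ c i, 0 ≤ K c i) ∧ (∀ c, ∑ i, K c i = 1) ∧
      ∀ F : A × B × C → ℝ, (∀ z, 0 ≤ F z) → (∀ z, F z ≤ 1) →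
        mean (bookLaw P q₁ q₂) (fun c => mean (K c) fun i => F (c.word i)) ≤
          8 * hi * (k₀ / lo / M + k₁ / lo / (M * M₁) + k₂ / lo / (M * M₂) + 1 / (M * M₁ * M₂)) +
          4 * hi / lo * mean w F := by
  set g : A × B × C → ℝ := fun z => if z ∈ T then 1 else 0 with hg
  have hg0 : ∀ z, 0 ≤ g z := fun z => by simp only [hg]; positivity
  have hMr : (0 : ℝ) < M := by exact_mod_cast hM
  have hM₁r : (0 : ℝ) < M₁ := by exact_mod_cast hM₁
  have hM₂r : (0 : ℝ) < M₂ := by exact_mod_cast hM₂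
  have : Nonempty (Fin M × Fin M₁ × Fin M₂) := ⟨(⟨0, hM⟩, ⟨0, hM₁⟩, ⟨0, hM₂⟩)⟩
  set Q := tripleLaw P q₁ q₂ with hQ
  have hQ0 : ∀ z, 0 ≤ Q z := fun z => mul_nonneg (hP0 _) (mul_nonneg (h10 _ _) (h20 _ _))
  -- The chance that one triple of codewords falls in `T`. Since `w` gives `T` mass at least one
  -- half and `w ≤ hi * Q` there, it is at least `1 / (2 * hi)`.
  set π := mean Q g with hπ
  have hπhi : 1 / 2 ≤ hi * π := by
    refine hwT.trans ?_
    rw [hπ, ← mean_const_mul]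
    refine Finset.sum_le_sum fun z _ => ?_
    by_cases hz : z ∈ T
    · simpa [hg, hz, mul_comm] using hT' z hz
    · simp [hg, hz]
  have hπ0 : 0 < π := by
    by_contra! h
    nlinarith
  set m : ℝ := M * (M₁ * M₂) with hm
  have hm0 : 0 < m := by positivity
  set S : Book M M₁ M₂ A B C → ℝ := fun c => ∑ i, g (c.word i) with hS
  -- Uniform over the index triples that hit `T`. If there are none, uniform over all of them, so
  -- that `K c` is always a probability.
  set K : Book M M₁ M₂ A B C → Fin M × Fin M₁ × Fin M₂ → ℝ := fun c i =>
    if S c = 0 then 1 / Fintype.card (Fin M × Fin M₁ × Fin M₂) else g (c.word i) / S c with hK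
  have hS0 : ∀ c, 0 ≤ S c := fun c => Finset.sum_nonneg fun i _ => hg0 _
  have hK0 : ∀ c i, 0 ≤ K c i := fun c i => by
    simp only [hK]
    have := hS0 c
    have := hg0 (c.word i)
    positivity
  have hK1 : ∀ c, ∑ i, K c i = 1 := fun c => by
    simp only [hK]
    split_ifs with h
    · rw [Finset.sum_const, Finset.card_univ, nsmul_eq_mul]
      exact mul_one_div_cancel (Nat.cast_ne_zero.2 Fintype.card_ne_zero)
    · rw [← Finset.sum_div]
      exact div_self h
  refine ⟨K, hK0, hK1, fun F hF0 hF1 => ?_⟩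
  -- Chebyshev's inequality pointwise: if `S c` is at most half its mean, the quadratic term is at
  -- least one. Otherwise `1 / S c ≤ 2 / (m * π)`.
  have hpt : ∀ c, (mean (K c) fun i => F (c.word i)) ≤
      4 / (m * π) ^ 2 * (S c - m * π) ^ 2 + 2 / (m * π) * ∑ i, (g (c.word i) * F (c.word i)) := by
    intro c
    have hmπ : 0 < m * π := by positivity
    rcases le_or_gt (S c) (m * π / 2) with hle | hgt
    · have e1 : (mean (K c) fun i => F (c.word i)) ≤ 1 := mean_le_one (hK0 c) (hK1 c) fun i => hF1 _
      have e2 : 0 ≤ 2 / (m * π) * ∑ i, (g (c.word i) * F (c.word i)) :=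
        mul_nonneg (by positivity) (Finset.sum_nonneg fun i _ => mul_nonneg (hg0 _) (hF0 _))
      have e3 : 1 ≤ 4 / (m * π) ^ 2 * (S c - m * π) ^ 2 := by
        rw [div_mul_eq_mul_div, le_div_iff₀ (by positivity)]
        nlinarith
      linarith
    · have hSc : 0 < S c := by linarith
      have e1 : 0 ≤ 4 / (m * π) ^ 2 * (S c - m * π) ^ 2 := by positivity
      have e2 : (mean (K c) fun i => F (c.word i)) =
          1 / S c * ∑ i, (g (c.word i) * F (c.word i)) := by
        simp only [mean, hK, hSc.ne', if_false, Finset.mul_sum]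
        exact Finset.sum_congr rfl fun i _ => by ring
      have e3 : 1 / S c ≤ 2 / (m * π) := by
        rw [div_le_div_iff₀ hSc hmπ]
        linarith
      have e4 := mul_le_mul_of_nonneg_right e3
        (Finset.sum_nonneg fun i (_ : i ∈ Finset.univ) =>
          mul_nonneg (hg0 (c.word i)) (hF0 (c.word i)))
      linarith
  refine (mean_mono (bookLaw_nonneg hP0 h10 h20) hpt).trans ?_
  rw [mean_add, mean_const_mul, mean_const_mul]
  refine add_le_add ?_ ?_
  -- The clusters are i.i.d., so the variance is at most `M` times the second moment of one cluster.
  · have v1 : mean (bookLaw P q₁ q₂) (fun c => (S c - m * π) ^ 2) ≤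
        M * mean (clusterLaw P q₁ q₂) (fun r : A × (Fin M₁ → B) × (Fin M₂ → C) =>
          clusterSum g r ^ 2) := by
      have := mean_iidLaw_variance_le (ι := Fin M) (p := clusterLaw P q₁ q₂)
        (sum_clusterLaw (M₁ := M₁) (M₂ := M₂) hP h₁ h₂) (clusterSum g)
      rw [Fintype.card_fin, mean_clusterSum h₁ h₂, ← mul_assoc, ← hm] at this
      simp only [hS, sum_word]
      exact (mean_bookLaw P q₁ q₂ (fun r => (∑ i, clusterSum g (r i) - m * π) ^ 2)).trans_le this
    have v2 := mean_clusterSum_indicator_sq_le (M₁ := M₁) (M₂ := M₂) hP0 h10 h20 h₁ h₂ hw hlo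
      hk₀ hk₁ hk₂ hT hT₀ hT₁ hT₂
    have v3 := v1.trans (mul_le_mul_of_nonneg_left v2 hMr.le)
    have hmπ : 0 < m * π := by positivity
    refine (mul_le_mul_of_nonneg_left v3 (by positivity)).trans ?_
    have hinv : 1 / π ≤ 2 * hi := by
      rw [div_le_iff₀ hπ0]
      linarith
    calc _ = 4 * (k₀ / lo / M + k₁ / lo / (M * M₁) + k₂ / lo / (M * M₂) + 1 / (M * M₁ * M₂))
          * (1 / π) := by
          simp only [hm]
          field_simp
          ring
      _ ≤ 4 * (k₀ / lo / M + k₁ / lo / (M * M₁) + k₂ / lo / (M * M₂) + 1 / (M * M₁ * M₂))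
          * (2 * hi) := mul_le_mul_of_nonneg_left hinv (by positivity)
      _ = _ := by ring
  · rw [mean_sum_word hP h₁ h₂ (fun z => g z * F z)]
    -- The change of measure: on `T` the law `Q` may be replaced by `w` at the cost `1 / lo`.
    have u1 : mean Q (fun z => g z * F z) ≤ 1 / lo * mean w F := by
      rw [← mean_const_mul]
      refine Finset.sum_le_sum fun z _ => ?_
      by_cases hz : z ∈ T
      · have := mul_le_mul_of_nonneg_right (hT z hz) (hF0 z)
        simp only [hg, hz, if_true]
        have h' : Q z * F z ≤ w z * F z / lo := by
          rw [le_div_iff₀ hlo]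
          linarith
        calc _ = Q z * F z := by ring
          _ ≤ _ := h'
          _ = _ := by ring
      · simp only [hg, hz, if_false]
        have := hw z
        have := hF0 z
        simp only [zero_mul, mul_zero]
        positivity
    have hwF : 0 ≤ mean w F := mean_nonneg hw hF0
    have hinv : 1 / π ≤ 2 * hi := by
      rw [div_le_iff₀ hπ0]
      linarith
    calc 2 / (m * π) * (M * (M₁ * M₂ * mean Q fun z => g z * F z))
        = 2 * (1 / π) * mean Q fun z => g z * F z := by
          simp only [hm]
          field_simp
      _ ≤ 2 * (2 * hi) * (1 / lo * mean w F) := by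
          refine mul_le_mul ?_ u1 ?_ (by positivity)
          · linarith
          · exact mean_nonneg hQ0 fun z => mul_nonneg (hg0 z) (hF0 z)
      _ = _ := by ring

end Covering

/-! ### Marginal mass functions. -/

section Marginals

variable {α β : Type*} [Fintype α]

open Classical in
/-- The mass function of `f` under the mass function `p`. -/
def marginal (p : α → ℝ) (f : α → β) (b : β) : ℝ := ∑ a, if f a = b then p a else 0

lemma marginal_nonneg {p : α → ℝ} (hp : ∀ a, 0 ≤ p a) (f : α → β) (b : β) :
    0 ≤ marginal p f b :=
  Finset.sum_nonneg fun a _ => by split_ifs <;> simp [hp a]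

lemma le_marginal {p : α → ℝ} (hp : ∀ a, 0 ≤ p a) (f : α → β) (a : α) :
    p a ≤ marginal p f (f a) := by
  classical
  have := Finset.single_le_sum (f := fun a' => if f a' = f a then p a' else 0)
    (fun a' _ => by split_ifs <;> simp [hp a']) (Finset.mem_univ a)
  simp only [if_true] at this
  exact this.trans_eq (by unfold marginal; congr!)

lemma marginal_pos {p : α → ℝ} (hp : ∀ a, 0 ≤ p a) (f : α → β) {a : α} (ha : p a ≠ 0) :
    0 < marginal p f (f a) :=
  ((hp a).lt_of_ne' ha).trans_le (le_marginal hp f a)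

lemma mean_marginal [Fintype β] (p : α → ℝ) (f : α → β) (g : β → ℝ) :
    mean (marginal p f) g = mean p fun a => g (f a) := by
  classical
  simp only [mean, marginal, Finset.sum_mul]
  rw [Finset.sum_comm]
  refine Finset.sum_congr rfl fun a _ => ?_
  rw [Finset.sum_eq_single (f a)]
  · simp
  · intro b _ hb
    simp [hb.symm]
  · simp

lemma sum_marginal [Fintype β] {p : α → ℝ} (hp : ∑ a, p a = 1) (f : α → β) :
    ∑ b, marginal p f b = 1 := by
  rw [sum_eq_mean_one, mean_marginal, mean_const hp]

end Marginals

/-! ### Likelihood ratios of product laws. -/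

section Likelihood

variable {α : Type*} {n : ℕ} {f g : α → ℝ} {s : Fin n → α}

/-- Converts sums of information densities, which concentrate, into likelihood ratios of blocks. -/
lemma prod_div_eq_two_rpow (hf : ∀ t, 0 < f (s t)) (hg : ∀ t, 0 < g (s t)) :
    ∏ t, f (s t) = 2 ^ (∑ t, Real.logb 2 (f (s t) / g (s t))) * ∏ t, g (s t) := by
  rw [Real.rpow_sum_of_pos (by norm_num), ← Finset.prod_mul_distrib]
  refine Finset.prod_congr rfl fun t _ => ?_
  rw [Real.rpow_logb (by norm_num) (by norm_num) (div_pos (hf t) (hg t)),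
    div_mul_cancel₀ _ (hg t).ne']

lemma prod_le_two_rpow_mul (hf : ∀ t, 0 < f (s t)) (hg : ∀ t, 0 < g (s t)) {r : ℝ}
    (h : ∑ t, Real.logb 2 (f (s t) / g (s t)) ≤ r) :
    ∏ t, f (s t) ≤ 2 ^ r * ∏ t, g (s t) := by
  rw [prod_div_eq_two_rpow hf hg]
  exact mul_le_mul_of_nonneg_right (Real.rpow_le_rpow_of_exponent_le (by norm_num) h)
    (Finset.prod_nonneg fun t _ => (hg t).le)

lemma two_rpow_mul_prod_le (hf : ∀ t, 0 < f (s t)) (hg : ∀ t, 0 < g (s t)) {r : ℝ}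
    (h : r ≤ ∑ t, Real.logb 2 (f (s t) / g (s t))) :
    2 ^ r * ∏ t, g (s t) ≤ ∏ t, f (s t) := by
  rw [prod_div_eq_two_rpow hf hg]
  exact mul_le_mul_of_nonneg_right (Real.rpow_le_rpow_of_exponent_le (by norm_num) h)
    (Finset.prod_nonneg fun t _ => (hg t).le)

end Likelihood

/-! ### Conditional laws, information densities and weak typicality at one terminal. -/

section Terminal

variable {X U V W : Type*} [Fintype X] [Fintype U] [Fintype V] [Fintype W]

/-- The sequence of tuples made of four sequences. -/
def zip₄ {n : ℕ} (x : Fin n → X) (z : (Fin n → U) × (Fin n → V) × (Fin n → W)) (t : Fin n) :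
    X × U × V × W :=
  (x t, z.1 t, z.2.1 t, z.2.2 t)

/-- Zipping is a bijection. -/
def zip₄Equiv (n : ℕ) (X U V W : Type*) :
    (Fin n → X) × (Fin n → U) × (Fin n → V) × (Fin n → W) ≃ (Fin n → X × U × V × W) where
  toFun y t := (y.1 t, y.2.1 t, y.2.2.1 t, y.2.2.2 t)
  invFun s := (fun t => (s t).1, fun t => (s t).2.1, fun t => (s t).2.2.1, fun t => (s t).2.2.2)
  left_inv _ := rfl
  right_inv _ := rfl

lemma sum_eq_sum_zip₄ {n : ℕ} (f : (Fin n → X × U × V × W) → ℝ) :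
    ∑ s, f s = ∑ x, ∑ z, f (zip₄ x z) := by
  rw [← (zip₄Equiv n X U V W).sum_comp, Fintype.sum_prod_type]
  rfl

lemma marginal_fst (p : X × U × V × W → ℝ) (x : X) :
    marginal p Prod.fst x = ∑ z, p (x, z) := by
  classical
  simp only [marginal]
  rw [Fintype.sum_prod_type, Finset.sum_comm]
  simp

lemma marginal_fst_snd (p : X × U × V × W → ℝ) (x : X) (u : U) :
    marginal p (fun z => (z.1, z.2.1)) (x, u) = ∑ v, ∑ w, p (x, u, v, w) := by
  classical
  simp only [marginal, Fintype.sum_prod_type, Prod.mk.injEq]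
  rw [Finset.sum_eq_single x (fun y _ hy => by simp [hy]) (by simp),
    Finset.sum_eq_single u (fun y _ hy => by simp [hy]) (by simp)]
  simp

lemma marginal_triple₁ (p : X × U × V × W → ℝ) (x : X) (u : U) (v : V) :
    marginal p (fun z => (z.1, z.2.1, z.2.2.1)) (x, u, v) = ∑ w, p (x, u, v, w) := by
  classical
  simp only [marginal, Fintype.sum_prod_type, Prod.mk.injEq]
  rw [Finset.sum_eq_single x (fun y _ hy => by simp [hy]) (by simp),
    Finset.sum_eq_single u (fun y _ hy => by simp [hy]) (by simp),
    Finset.sum_eq_single v (fun y _ hy => by simp [hy]) (by simp)]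
  simp

lemma marginal_triple₂ (p : X × U × V × W → ℝ) (x : X) (u : U) (w : W) :
    marginal p (fun z => (z.1, z.2.1, z.2.2.2)) (x, u, w) = ∑ v, p (x, u, v, w) := by
  classical
  simp only [marginal, Fintype.sum_prod_type, Prod.mk.injEq]
  rw [Finset.sum_eq_single x (fun y _ hy => by simp [hy]) (by simp),
    Finset.sum_eq_single u (fun y _ hy => by simp [hy]) (by simp)]
  refine Finset.sum_congr rfl fun v _ => ?_
  rw [Finset.sum_eq_single w (fun y _ hy => by simp [hy]) (by simp)]
  simp

lemma sum_iidLaw_zip₄_right {n : ℕ} (p : X × U × V × W → ℝ) (x : Fin n → X) (a : Fin n → U)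
    (b : Fin n → V) : ∑ c, iidLaw p (zip₄ x (a, b, c)) =
      ∏ t, marginal p (fun z => (z.1, z.2.1, z.2.2.1)) (x t, a t, b t) := by
  simp only [marginal_triple₁]
  exact sum_prod_pi (fun t w => p (x t, a t, b t, w))

lemma sum_iidLaw_zip₄_mid {n : ℕ} (p : X × U × V × W → ℝ) (x : Fin n → X) (a : Fin n → U)
    (c : Fin n → W) : ∑ b, iidLaw p (zip₄ x (a, b, c)) =
      ∏ t, marginal p (fun z => (z.1, z.2.1, z.2.2.2)) (x t, a t, c t) := by
  simp only [marginal_triple₂]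
  exact sum_prod_pi (fun t v => p (x t, a t, v, c t))

lemma sum_iidLaw_zip₄_mid_right {n : ℕ} (p : X × U × V × W → ℝ) (x : Fin n → X) (a : Fin n → U) :
    ∑ b, ∑ c, iidLaw p (zip₄ x (a, b, c)) =
      ∏ t, marginal p (fun z => (z.1, z.2.1)) (x t, a t) := by
  simp only [sum_iidLaw_zip₄_right, marginal_triple₁, marginal_fst_snd]
  exact sum_prod_pi (fun t v => ∑ w, p (x t, a t, v, w))

lemma sum_iidLaw_zip₄ {n : ℕ} (p : X × U × V × W → ℝ) (x : Fin n → X) :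
    ∑ z, iidLaw p (zip₄ x z) = iidLaw (marginal p Prod.fst) x := by
  rw [Fintype.sum_prod_type]
  simp only [Fintype.sum_prod_type (α₁ := Fin n → V), sum_iidLaw_zip₄_mid_right, marginal_fst_snd]
  simp only [iidLaw, marginal_fst, Fintype.sum_prod_type]
  exact sum_prod_pi (fun t u => ∑ v, ∑ w, p (x t, u, v, w))

/-- The law of the other three sequences given the first one. -/
def condLaw {n : ℕ} (p : X × U × V × W → ℝ) (x : Fin n → X)
    (z : (Fin n → U) × (Fin n → V) × (Fin n → W)) : ℝ :=
  iidLaw p (zip₄ x z) / iidLaw (marginal p Prod.fst) x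

/-- The value zero that division gives to `condLaw` at a null block is harmless, because a null
block extends only to null tuples. -/
lemma condLaw_mul {n : ℕ} {p : X × U × V × W → ℝ} (hp : ∀ z, 0 ≤ p z) (x : Fin n → X)
    (z : (Fin n → U) × (Fin n → V) × (Fin n → W)) :
    iidLaw (marginal p Prod.fst) x * condLaw p x z = iidLaw p (zip₄ x z) := by
  by_cases h : iidLaw (marginal p Prod.fst) x = 0
  · rw [h, zero_mul]
    refine le_antisymm (iidLaw_nonneg hp _) ?_
    rw [← h, ← sum_iidLaw_zip₄]
    exact Finset.single_le_sum (f := fun z => iidLaw p (zip₄ x z))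
      (fun z _ => iidLaw_nonneg hp _) (Finset.mem_univ z)
  · exact mul_div_cancel₀ _ h

lemma condLaw_nonneg {n : ℕ} {p : X × U × V × W → ℝ} (hp : ∀ z, 0 ≤ p z) (x : Fin n → X)
    (z : (Fin n → U) × (Fin n → V) × (Fin n → W)) : 0 ≤ condLaw p x z :=
  div_nonneg (iidLaw_nonneg hp _) (iidLaw_nonneg (marginal_nonneg hp _) _)

/-- Information density of a triple drawn jointly, against an independent superposition triple. -/
def density₀ (p : X × U × V × W → ℝ) (P : U → ℝ) (q₁ : U → V → ℝ) (q₂ : U → W → ℝ)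
    (z : X × U × V × W) : ℝ :=
  Real.logb 2 (p z / (marginal p Prod.fst z.1 * tripleLaw P q₁ q₂ z.2))

/-- Information density of the first letter and a function of the tuple. -/
def density {Y : Type*} (p : X × U × V × W → ℝ) (f : X × U × V × W → Y)
    (z : X × U × V × W) : ℝ :=
  Real.logb 2 (marginal p (fun z => (z.1, f z)) (z.1, f z) /
    (marginal p Prod.fst z.1 * marginal p f (f z)))

/-- Weakly typical sequences of tuples. -/
def WeaklyTypical {n : ℕ} (p : X × U × V × W → ℝ) (P : U → ℝ) (q₁ : U → V → ℝ) (q₂ : U → W → ℝ)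
    (γ : ℝ) (s : Fin n → X × U × V × W) : Prop :=
  (∀ t, p (s t) ≠ 0) ∧
    n * (mean p (density₀ p P q₁ q₂) - γ) < ∑ t, density₀ p P q₁ q₂ (s t) ∧
    ∑ t, density₀ p P q₁ q₂ (s t) < n * (mean p (density₀ p P q₁ q₂) + γ) ∧
    ∑ t, density p (fun z => z.2.1) (s t) < n * (mean p (density p fun z => z.2.1) + γ) ∧
    ∑ t, density p (fun z => (z.2.1, z.2.2.1)) (s t) <
      n * (mean p (density p fun z => (z.2.1, z.2.2.1)) + γ) ∧
    ∑ t, density p (fun z => (z.2.1, z.2.2.2)) (s t) <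
      n * (mean p (density p fun z => (z.2.1, z.2.2.2)) + γ)

/-- Each of the five inequalities fails with exponentially small probability by Chernoff. `density₀`
is controlled on both sides because it yields both `lo` and `hi` of `exists_selection`. The other
densities only yield the upper bounds `k₀`, `k₁`, `k₂`. -/
lemma eventually_prob_not_weaklyTypical_le {p : X × U × V × W → ℝ} (hp0 : ∀ z, 0 ≤ p z)
    (hp1 : ∑ z, p z = 1) (P : U → ℝ) (q₁ : U → V → ℝ) (q₂ : U → W → ℝ) {γ θ : ℝ} (hγ : 0 < γ)
    (hθ : 0 < θ) :
    ∀ᶠ n : ℕ in atTop, prob (iidLaw p)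
      (fun s : Fin n → X × U × V × W => ¬ WeaklyTypical p P q₁ q₂ γ s) ≤ θ := by
  obtain ⟨c₀, hc₀, h₀⟩ := prob_iidLaw_le_sum_le hp0 hp1 (density₀ p P q₁ q₂) hγ
  obtain ⟨c₁, hc₁, h₁⟩ := prob_iidLaw_sum_ge_le hp0 hp1 (density₀ p P q₁ q₂) hγ
  obtain ⟨c₂, hc₂, h₂⟩ := prob_iidLaw_sum_ge_le hp0 hp1 (density p fun z => z.2.1) hγ
  obtain ⟨c₃, hc₃, h₃⟩ := prob_iidLaw_sum_ge_le hp0 hp1 (density p fun z => (z.2.1, z.2.2.1)) hγ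
  obtain ⟨c₄, hc₄, h₄⟩ := prob_iidLaw_sum_ge_le hp0 hp1 (density p fun z => (z.2.1, z.2.2.2)) hγ
  have hlim : Tendsto (fun n : ℕ => (2 : ℝ) ^ (-(c₀ * n)) + ((2 : ℝ) ^ (-(c₁ * n)) +
      ((2 : ℝ) ^ (-(c₂ * n)) + ((2 : ℝ) ^ (-(c₃ * n)) + (2 : ℝ) ^ (-(c₄ * n)))))) atTop (𝓝 0) := by
    simpa using (tendsto_two_rpow_neg hc₀).add ((tendsto_two_rpow_neg hc₁).add
      ((tendsto_two_rpow_neg hc₂).add ((tendsto_two_rpow_neg hc₃).add (tendsto_two_rpow_neg hc₄))))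
  filter_upwards [hlim.eventually (ge_mem_nhds hθ)] with n hn
  refine le_trans ?_ hn
  have hnn := iidLaw_nonneg (ι := Fin n) hp0
  refine (prob_mono hnn ?_).trans ((prob_or_le hnn _ _).trans
    (add_le_add (h₀ n) ((prob_or_le hnn _ _).trans (add_le_add (h₁ n)
    ((prob_or_le hnn _ _).trans (add_le_add (h₂ n)
    ((prob_or_le hnn _ _).trans (add_le_add (h₃ n) (h₄ n)))))))))
  intro s hs hT
  by_contra! hcon
  exact hT ⟨fun t ht => hs (Finset.prod_eq_zero (Finset.mem_univ t) ht), hcon⟩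

open Classical in
/-- With high probability, the first sequence is likely to be extended to a typical tuple. -/
lemma prob_not_extends_le {n : ℕ} {p : X × U × V × W → ℝ} (hp0 : ∀ z, 0 ≤ p z)
    (T : (Fin n → X × U × V × W) → Prop) :
    prob (iidLaw (marginal p Prod.fst)) (fun x : Fin n → X =>
        ¬ 1 / 2 ≤ mean (condLaw p x) fun z => if T (zip₄ x z) then 1 else 0) ≤
      2 * prob (iidLaw p) (fun s => ¬ T s) := by
  unfold prob
  rw [← mean_const_mul]
  unfold mean
  rw [sum_eq_sum_zip₄]
  refine Finset.sum_le_sum fun x _ => ?_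
  beta_reduce
  have hR0 : 0 ≤ ∑ z, iidLaw p (zip₄ x z) * (2 * if ¬ T (zip₄ x z) then (1 : ℝ) else 0) :=
    Finset.sum_nonneg fun z _ => mul_nonneg (iidLaw_nonneg hp0 _) (by positivity)
  split_ifs with hx
  · simpa using hR0
  · rw [mul_one]
    -- Markov's inequality: a bad `x` has more than half of its conditional mass on tuples outside
    -- `T`, which gives the factor two.
    have h1 : ∑ z, iidLaw p (zip₄ x z) * (if T (zip₄ x z) then (1 : ℝ) else 0) ≤
        iidLaw (marginal p Prod.fst) x * (1 / 2) := by
      have := mul_le_mul_of_nonneg_left (not_le.1 hx).le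
        (iidLaw_nonneg (marginal_nonneg hp0 Prod.fst) x)
      rw [Finset.mul_sum] at this
      refine le_trans (le_of_eq (Finset.sum_congr rfl fun z _ => ?_)) this
      rw [← condLaw_mul hp0, mul_assoc]
    have h2 : ∑ z, iidLaw p (zip₄ x z) * (2 * if ¬ T (zip₄ x z) then (1 : ℝ) else 0) =
        2 * iidLaw (marginal p Prod.fst) x -
          2 * ∑ z, iidLaw p (zip₄ x z) * (if T (zip₄ x z) then (1 : ℝ) else 0) := by
      rw [← sum_iidLaw_zip₄, Finset.mul_sum, Finset.mul_sum, ← Finset.sum_sub_distrib]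
      refine Finset.sum_congr rfl fun z _ => ?_
      by_cases h : T (zip₄ x z) <;> simp [h, mul_comm]
    have h3 : iidLaw (marginal p Prod.fst) x ≤
        ∑ z, iidLaw p (zip₄ x z) * (2 * if ¬ T (zip₄ x z) then (1 : ℝ) else 0) := by
      rw [h2]
      linarith
    exact h3.trans_eq (by congr!)

end Terminal

/-! ### Covering for blocks at rates above the information bounds. -/

section Block

variable {X U V W : Type*} [Fintype X] [Fintype U] [Fintype V] [Fintype W]

/-- The memoryless extension of a kernel. -/
def blockKernel {n : ℕ} {α β : Type*} (q : α → β → ℝ) (a : Fin n → α) (b : Fin n → β) : ℝ :=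
  ∏ t, q (a t) (b t)

lemma blockKernel_nonneg {n : ℕ} {α β : Type*} {q : α → β → ℝ} (hq : ∀ a b, 0 ≤ q a b)
    (a : Fin n → α) (b : Fin n → β) : 0 ≤ blockKernel q a b :=
  Finset.prod_nonneg fun _ _ => hq _ _

lemma sum_blockKernel {n : ℕ} {α β : Type*} [Fintype β] {q : α → β → ℝ}
    (hq : ∀ a, ∑ b, q a b = 1) (a : Fin n → α) : ∑ b, blockKernel q a b = 1 := by
  simp only [blockKernel]
  rw [sum_prod_pi (fun t b => q (a t) b)]
  simp [hq]

/-- Rounding down loses less than one codeword. This is at most half because `0 ≤ R` leaves at least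
one codeword. -/
lemma half_two_rpow_le_codebookSize (n : ℕ) {R : ℝ} (hR : 0 ≤ R) :
    (2 : ℝ) ^ ((n : ℝ) * R) / 2 ≤ codebookSize n R := by
  have h1 : (1 : ℝ) ≤ (2 : ℝ) ^ ((n : ℝ) * R) := Real.one_le_rpow (by norm_num) (by positivity)
  have h2 : 1 ≤ codebookSize n R := Nat.le_floor (by simpa using h1)
  have h3 : (2 : ℝ) ^ ((n : ℝ) * R) < codebookSize n R + 1 := Nat.lt_floor_add_one _
  have h4 : (1 : ℝ) ≤ codebookSize n R := by exact_mod_cast h2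
  linarith

lemma codebookSize_pos (n : ℕ) {R : ℝ} (hR : 0 ≤ R) : 0 < codebookSize n R := by
  have h1 : (1 : ℝ) ≤ (2 : ℝ) ^ ((n : ℝ) * R) := Real.one_le_rpow (by norm_num) (by positivity)
  exact Nat.le_floor (by simpa using h1)

lemma one_div_codebookSize_le (n : ℕ) {R : ℝ} (hR : 0 ≤ R) :
    1 / (codebookSize n R : ℝ) ≤ 2 * (2 : ℝ) ^ (-((n : ℝ) * R)) := by
  have h := half_two_rpow_le_codebookSize n hR
  have h2 : (0 : ℝ) < codebookSize n R := by exact_mod_cast codebookSize_pos n hR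
  rw [div_le_iff₀ h2, Real.rpow_neg (by norm_num)]
  have h0 : (0 : ℝ) < 2 ^ ((n : ℝ) * R) := by positivity
  calc (1 : ℝ) = 2 * (2 ^ ((n : ℝ) * R))⁻¹ * (2 ^ ((n : ℝ) * R) / 2) := by field_simp
    _ ≤ _ := mul_le_mul_of_nonneg_left h (by positivity)

lemma tripleLaw_block {X U V W : Type*} {n : ℕ} (P : U → ℝ) (q₁ : U → V → ℝ) (q₂ : U → W → ℝ)
    (x : Fin n → X) (z : (Fin n → U) × (Fin n → V) × (Fin n → W)) :
    tripleLaw (iidLaw P) (blockKernel q₁) (blockKernel q₂) z =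
      ∏ t, tripleLaw P q₁ q₂ (zip₄ x z t).2 := by
  simp only [tripleLaw, iidLaw, blockKernel, zip₄, Finset.prod_mul_distrib]

/-- The mass functions of a codeword letter and its satellites agree with the joint one. -/
structure IsSuperposition (p : X × U × V × W → ℝ) (P : U → ℝ) (q₁ : U → V → ℝ)
    (q₂ : U → W → ℝ) : Prop where
  nonneg : ∀ z, 0 ≤ p z
  sum_eq_one : ∑ z, p z = 1
  marginal_eq : ∀ u, marginal p (fun z => z.2.1) u = P u
  nonneg₁ : ∀ u v, 0 ≤ q₁ u v
  nonneg₂ : ∀ u w, 0 ≤ q₂ u w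
  sum_eq_one₁ : ∀ u, ∑ v, q₁ u v = 1
  sum_eq_one₂ : ∀ u, ∑ w, q₂ u w = 1
  marginal_eq₁ : ∀ u v, marginal p (fun z => (z.2.1, z.2.2.1)) (u, v) = P u * q₁ u v
  marginal_eq₂ : ∀ u w, marginal p (fun z => (z.2.1, z.2.2.2)) (u, w) = P u * q₂ u w

namespace IsSuperposition

variable {p : X × U × V × W → ℝ} {P : U → ℝ} {q₁ : U → V → ℝ} {q₂ : U → W → ℝ}
  (h : IsSuperposition p P q₁ q₂) {n : ℕ}

include h

lemma law_nonneg (u : U) : 0 ≤ P u := by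
  rw [← h.marginal_eq]
  exact marginal_nonneg h.nonneg _ _

lemma sum_law : ∑ u, P u = 1 := by
  simp only [← h.marginal_eq]
  exact sum_marginal h.sum_eq_one _

/-- The joint law is absolutely continuous with respect to the superposition law, since the two
share the pair marginals. Hence `density₀` is a genuine log-likelihood ratio on the support. -/
lemma tripleLaw_pos {z : X × U × V × W} (hz : p z ≠ 0) : 0 < tripleLaw P q₁ q₂ z.2 := by
  have h0 : 0 < P z.2.1 := by
    rw [← h.marginal_eq]
    exact marginal_pos h.nonneg (fun z => z.2.1) hz
  have h1 : 0 < P z.2.1 * q₁ z.2.1 z.2.2.1 := by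
    rw [← h.marginal_eq₁]
    exact marginal_pos h.nonneg (fun z => (z.2.1, z.2.2.1)) hz
  have h2 : 0 < P z.2.1 * q₂ z.2.1 z.2.2.2 := by
    rw [← h.marginal_eq₂]
    exact marginal_pos h.nonneg (fun z => (z.2.1, z.2.2.2)) hz
  exact mul_pos h0 (mul_pos (pos_of_mul_pos_right h1 h0.le) (pos_of_mul_pos_right h2 h0.le))

/-- The left side is the conditional law, given the source block, of the block of values of `f`. The
three choices of `f` supply `k₀`, `k₁`, `k₂` in `exists_selection`. -/
lemma density_bound {Y : Type*} (f : X × U × V × W → Y) {s : Fin n → X × U × V × W}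
    (hs : ∀ t, p (s t) ≠ 0) {r : ℝ} (hr : ∑ t, density p f (s t) ≤ r) :
    (∏ t, marginal p (fun z => (z.1, f z)) ((s t).1, f (s t))) /
        iidLaw (marginal p Prod.fst) (fun t => (s t).1) ≤ 2 ^ r * ∏ t, marginal p f (f (s t)) := by
  have hX : ∀ t, 0 < marginal p Prod.fst (s t).1 := fun t => marginal_pos h.nonneg _ (hs t)
  have hf : ∀ t, 0 < marginal p f (f (s t)) := fun t => marginal_pos h.nonneg _ (hs t)
  have hXf : ∀ t, 0 < marginal p (fun z => (z.1, f z)) ((s t).1, f (s t)) := fun t =>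
    marginal_pos h.nonneg (fun z => (z.1, f z)) (hs t)
  have h0 : 0 < iidLaw (marginal p Prod.fst) (fun t => (s t).1) :=
    Finset.prod_pos fun t _ => hX t
  rw [div_le_iff₀ h0]
  have := prod_le_two_rpow_mul (f := fun z => marginal p (fun z => (z.1, f z)) (z.1, f z))
    (g := fun z => marginal p Prod.fst z.1 * marginal p f (f z)) (s := s) hXf
    (fun t => mul_pos (hX t) (hf t)) hr
  rw [Finset.prod_mul_distrib] at this
  unfold iidLaw
  linarith

lemma condLaw_bounds {x : Fin n → X} {z : (Fin n → U) × (Fin n → V) × (Fin n → W)}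
    (hs : ∀ t, p (zip₄ x z t) ≠ 0) {r r' : ℝ}
    (hr : r ≤ ∑ t, density₀ p P q₁ q₂ (zip₄ x z t))
    (hr' : ∑ t, density₀ p P q₁ q₂ (zip₄ x z t) ≤ r') :
    2 ^ r * tripleLaw (iidLaw P) (blockKernel q₁) (blockKernel q₂) z ≤ condLaw p x z ∧
      condLaw p x z ≤ 2 ^ r' * tripleLaw (iidLaw P) (blockKernel q₁) (blockKernel q₂) z := by
  have hX : ∀ t, 0 < marginal p Prod.fst (zip₄ x z t).1 := fun t =>
    marginal_pos h.nonneg _ (hs t)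
  have hQ : ∀ t, 0 < tripleLaw P q₁ q₂ (zip₄ x z t).2 := fun t => h.tripleLaw_pos (hs t)
  have hp : ∀ t, 0 < p (zip₄ x z t) := fun t => (h.nonneg _).lt_of_ne' (hs t)
  have h0 : 0 < iidLaw (marginal p Prod.fst) x := Finset.prod_pos fun t _ => hX t
  have e1 := two_rpow_mul_prod_le (f := p)
    (g := fun z => marginal p Prod.fst z.1 * tripleLaw P q₁ q₂ z.2) hp
    (fun t => mul_pos (hX t) (hQ t)) hr
  have e2 := prod_le_two_rpow_mul (f := p)
    (g := fun z => marginal p Prod.fst z.1 * tripleLaw P q₁ q₂ z.2) hp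
    (fun t => mul_pos (hX t) (hQ t)) hr'
  rw [Finset.prod_mul_distrib, ← tripleLaw_block P q₁ q₂ x z] at e1 e2
  have e3 : ∏ t, marginal p Prod.fst (zip₄ x z t).1 = iidLaw (marginal p Prod.fst) x := rfl
  rw [e3] at e1 e2
  unfold condLaw
  rw [le_div_iff₀ h0, div_le_iff₀ h0]
  change _ ∧ ∏ t, p (zip₄ x z t) ≤ _
  constructor
  · change _ ≤ ∏ t, p (zip₄ x z t)
    linarith
  · linarith

open Classical in
/-- Mutual covering for a block that can be extended to a weakly typical tuple. -/
theorem exists_block_selection {γ : ℝ} {M M₁ M₂ : ℕ} (hM : 0 < M) (hM₁ : 0 < M₁) (hM₂ : 0 < M₂)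
    (x : Fin n → X)
    (hx : 1 / 2 ≤ mean (condLaw p x) fun z =>
      if WeaklyTypical p P q₁ q₂ γ (zip₄ x z) then 1 else 0) :
    ∃ K : Book M M₁ M₂ (Fin n → U) (Fin n → V) (Fin n → W) → Fin M × Fin M₁ × Fin M₂ → ℝ,
      (∀ c i, 0 ≤ K c i) ∧ (∀ c, ∑ i, K c i = 1) ∧
      ∀ F : (Fin n → U) × (Fin n → V) × (Fin n → W) → ℝ, (∀ z, 0 ≤ F z) → (∀ z, F z ≤ 1) →
        mean (bookLaw (iidLaw P) (blockKernel q₁) (blockKernel q₂))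
            (fun c => mean (K c) fun i => F (c.word i)) ≤
          8 * ((2 : ℝ) ^ (n * (mean p (density p fun z => z.2.1) + 3 * γ)) * (1 / M) +
            (2 : ℝ) ^ (n * (mean p (density p fun z => (z.2.1, z.2.2.1)) + 3 * γ)) *
              ((1 / M) * (1 / M₁)) +
            (2 : ℝ) ^ (n * (mean p (density p fun z => (z.2.1, z.2.2.2)) + 3 * γ)) *
              ((1 / M) * (1 / M₂)) +
            (2 : ℝ) ^ (n * (mean p (density₀ p P q₁ q₂) + γ)) *
              ((1 / M) * (1 / M₁) * (1 / M₂))) +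
          4 * (2 : ℝ) ^ (n * (2 * γ)) * mean (condLaw p x) F := by
  set I₀ := mean p (density₀ p P q₁ q₂)
  set J₀ := mean p (density p fun z => z.2.1)
  set J₁ := mean p (density p fun z => (z.2.1, z.2.2.1))
  set J₂ := mean p (density p fun z => (z.2.1, z.2.2.2))
  obtain ⟨K, hK0, hK1, hK⟩ := exists_selection (M := M) (M₁ := M₁) (M₂ := M₂)
    (P := iidLaw (ι := Fin n) P) (q₁ := blockKernel q₁) (q₂ := blockKernel q₂)
    (T := {z | WeaklyTypical p P q₁ q₂ γ (zip₄ x z)}) (w := condLaw p x)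
    (lo := 2 ^ (n * (I₀ - γ))) (hi := 2 ^ (n * (I₀ + γ))) (k₀ := 2 ^ (n * (J₀ + γ)))
    (k₁ := 2 ^ (n * (J₁ + γ))) (k₂ := 2 ^ (n * (J₂ + γ)))
    hM hM₁ hM₂ (iidLaw_nonneg h.law_nonneg) (blockKernel_nonneg h.nonneg₁)
    (blockKernel_nonneg h.nonneg₂) (sum_iidLaw _ h.sum_law) (sum_blockKernel h.sum_eq_one₁)
    (sum_blockKernel h.sum_eq_one₂) (condLaw_nonneg h.nonneg x) (by positivity) (by positivity)
    (by positivity) (by positivity) (by positivity) hx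
    (fun z hz => (h.condLaw_bounds hz.1 hz.2.1.le hz.2.2.1.le).1)
    (fun z hz => (h.condLaw_bounds hz.1 hz.2.1.le hz.2.2.1.le).2)
    (fun a b c hz => by
      have := h.density_bound (fun z => z.2.1) hz.1 hz.2.2.2.1.le
      simp only [condLaw, ← Finset.sum_div, sum_iidLaw_zip₄_mid_right]
      simp only [h.marginal_eq] at this
      exact this)
    (fun a b c hz => by
      have := h.density_bound (fun z => (z.2.1, z.2.2.1)) hz.1 hz.2.2.2.2.1.le
      simp only [condLaw, ← Finset.sum_div, sum_iidLaw_zip₄_right]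
      simp only [h.marginal_eq₁, Finset.prod_mul_distrib] at this
      exact this)
    (fun a b c hz => by
      have := h.density_bound (fun z => (z.2.1, z.2.2.2)) hz.1 hz.2.2.2.2.2.le
      simp only [condLaw, ← Finset.sum_div, sum_iidLaw_zip₄_mid]
      simp only [h.marginal_eq₂, Finset.prod_mul_distrib] at this
      exact this)
  refine ⟨K, hK0, hK1, fun F hF0 hF1 => (hK F hF0 hF1).trans_eq ?_⟩
  have two : (0 : ℝ) < 2 := by norm_num
  -- The slack `3 * γ` collects one `γ` from each of `hi`, `k` and `1 / lo`. The ratio `hi / lo`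
  -- costs `2 * γ`.
  have e (J : ℝ) : (2 : ℝ) ^ (n * (I₀ + γ)) * (2 ^ (n * (J + γ)) / 2 ^ (n * (I₀ - γ))) =
      2 ^ (n * (J + 3 * γ)) := by
    rw [← Real.rpow_sub two, ← Real.rpow_add two]
    congr 1
    ring
  have e' : (2 : ℝ) ^ (n * (I₀ + γ)) / 2 ^ (n * (I₀ - γ)) = 2 ^ (n * (2 * γ)) := by
    rw [← Real.rpow_sub two]
    congr 1
    ring
  rw [← e J₀, ← e J₁, ← e J₂, ← e']
  ring

/-- Mutual covering at rates above the mutual information bounds. -/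
theorem eventually_exists_block_selection {R R₁ R₂ : ℝ} (hR : 0 ≤ R) (hR₁ : 0 ≤ R₁) (hR₂ : 0 ≤ R₂)
    {Δ γ : ℝ} (hγ : 0 < γ)
    (h₀ : mean p (density p fun z => z.2.1) + Δ ≤ R)
    (h₁ : mean p (density p fun z => (z.2.1, z.2.2.1)) + Δ ≤ R + R₁)
    (h₂ : mean p (density p fun z => (z.2.1, z.2.2.2)) + Δ ≤ R + R₂)
    (h₃ : mean p (density₀ p P q₁ q₂) + Δ ≤ R + R₁ + R₂) {θ : ℝ} (hθ : 0 < θ) :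
    ∀ᶠ n : ℕ in atTop, ∃ (G : (Fin n → X) → Prop)
      (K : (Fin n → X) → Book (codebookSize n R) (codebookSize n R₁) (codebookSize n R₂)
          (Fin n → U) (Fin n → V) (Fin n → W) →
        Fin (codebookSize n R) × Fin (codebookSize n R₁) × Fin (codebookSize n R₂) → ℝ),
      prob (iidLaw (marginal p Prod.fst)) (fun x => ¬ G x) ≤ θ ∧
      (∀ x c i, 0 ≤ K x c i) ∧ (∀ x c, ∑ i, K x c i = 1) ∧
      ∀ x, G x → ∀ F : (Fin n → U) × (Fin n → V) × (Fin n → W) → ℝ,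
        (∀ z, 0 ≤ F z) → (∀ z, F z ≤ 1) →
        mean (bookLaw (iidLaw P) (blockKernel q₁) (blockKernel q₂))
            (fun c => mean (K x c) fun i => F (c.word i)) ≤
          144 * (2 : ℝ) ^ (-((Δ - 3 * γ) * n)) +
          4 * (2 : ℝ) ^ (n * (2 * γ)) * mean (condLaw p x) F := by
  classical
  filter_upwards [eventually_prob_not_weaklyTypical_le h.nonneg h.sum_eq_one P q₁ q₂ hγ
    (half_pos hθ)] with n hn
  set M := codebookSize n R with hM
  set M₁ := codebookSize n R₁ with hM₁
  set M₂ := codebookSize n R₂ with hM₂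
  have hMp : 0 < M := codebookSize_pos n hR
  have hM₁p : 0 < M₁ := codebookSize_pos n hR₁
  have hM₂p : 0 < M₂ := codebookSize_pos n hR₂
  set G : (Fin n → X) → Prop := fun x => 1 / 2 ≤ mean (condLaw p x) fun z =>
      if WeaklyTypical p P q₁ q₂ γ (zip₄ x z) then 1 else 0 with hG
  have key : ∀ x : Fin n → X,
      ∃ K : Book M M₁ M₂ (Fin n → U) (Fin n → V) (Fin n → W) → Fin M × Fin M₁ × Fin M₂ → ℝ,
      (∀ c i, 0 ≤ K c i) ∧ (∀ c, ∑ i, K c i = 1) ∧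
      (G x → ∀ F : (Fin n → U) × (Fin n → V) × (Fin n → W) → ℝ,
        (∀ z, 0 ≤ F z) → (∀ z, F z ≤ 1) →
        mean (bookLaw (iidLaw P) (blockKernel q₁) (blockKernel q₂))
            (fun c => mean (K c) fun i => F (c.word i)) ≤
          144 * (2 : ℝ) ^ (-((Δ - 3 * γ) * n)) +
          4 * (2 : ℝ) ^ (n * (2 * γ)) * mean (condLaw p x) F) := by
    intro x
    by_cases hx : G x
    · obtain ⟨K, hK0, hK1, hK⟩ := h.exists_block_selection hMp hM₁p hM₂p x hx
      refine ⟨K, hK0, hK1, fun _ F hF0 hF1 => (hK F hF0 hF1).trans ?_⟩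
      have a₀ := one_div_codebookSize_le n hR
      have a₁ := one_div_codebookSize_le n hR₁
      have a₂ := one_div_codebookSize_le n hR₂
      rw [← hM] at a₀
      rw [← hM₁] at a₁
      rw [← hM₂] at a₂
      have two : (0 : ℝ) < 2 := by norm_num
      have hnn : (0 : ℝ) ≤ n := by positivity
      have b₁ : 1 / (M : ℝ) * (1 / M₁) ≤ 4 * 2 ^ (-((n : ℝ) * (R + R₁))) := by
        refine (mul_le_mul a₀ a₁ (by positivity) (by positivity)).trans_eq ?_
        rw [mul_add, neg_add, Real.rpow_add two]
        ring
      have b₂ : 1 / (M : ℝ) * (1 / M₂) ≤ 4 * 2 ^ (-((n : ℝ) * (R + R₂))) := by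
        refine (mul_le_mul a₀ a₂ (by positivity) (by positivity)).trans_eq ?_
        rw [mul_add, neg_add, Real.rpow_add two]
        ring
      have b₃ : 1 / (M : ℝ) * (1 / M₁) * (1 / M₂) ≤ 8 * 2 ^ (-((n : ℝ) * (R + R₁ + R₂))) := by
        refine (mul_le_mul b₁ a₂ (by positivity) (by positivity)).trans_eq ?_
        rw [mul_add _ (R + R₁), neg_add, Real.rpow_add two]
        ring
      have c (J S : ℝ) (hJ : J + Δ ≤ S) {k y g : ℝ} (hk : 0 ≤ k) (hg : g ≤ 3 * γ)
          (hy : y ≤ k * 2 ^ (-((n : ℝ) * S))) :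
          (2 : ℝ) ^ (n * (J + g)) * y ≤ k * 2 ^ (-((Δ - 3 * γ) * n)) := by
        calc _ ≤ (2 : ℝ) ^ (n * (J + g)) * (k * 2 ^ (-((n : ℝ) * S))) := by gcongr
          _ = k * 2 ^ (n * (J + g) + -(n * S)) := by
              rw [Real.rpow_add two]
              ring
          _ ≤ _ := by
              refine mul_le_mul_of_nonneg_left
                (Real.rpow_le_rpow_of_exponent_le (by norm_num) ?_) hk
              nlinarith
      -- The constants 2, 4, 4, 8 come from rounding one, two, two and three codebook sizes. With
      -- the factor 8 in front they give `8 * 18 = 144`.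
      have d₀ := c _ _ h₀ (by norm_num) le_rfl a₀
      have d₁ := c _ _ h₁ (by norm_num) le_rfl b₁
      have d₂ := c _ _ h₂ (by norm_num) le_rfl b₂
      have d₃ := c _ _ h₃ (g := γ) (by norm_num) (by linarith) b₃
      linarith
    -- Nothing is claimed for a bad block, so any probability on the indices serves.
    · have : Nonempty (Fin M × Fin M₁ × Fin M₂) := ⟨(⟨0, hMp⟩, ⟨0, hM₁p⟩, ⟨0, hM₂p⟩)⟩
      refine ⟨fun _ _ => 1 / Fintype.card (Fin M × Fin M₁ × Fin M₂), fun _ _ => by positivity,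
        fun _ => ?_, fun hx' => absurd hx' hx⟩
      rw [Finset.sum_const, Finset.card_univ, nsmul_eq_mul]
      exact mul_one_div_cancel (Nat.cast_ne_zero.2 Fintype.card_ne_zero)
  choose K hK0 hK1 hK using key
  refine ⟨G, K, ?_, hK0, hK1, hK⟩
  have := prob_not_extends_le (n := n) h.nonneg (WeaklyTypical p P q₁ q₂ γ)
  refine this.trans ?_
  linarith

end IsSuperposition

end Block

/-! ### From random to deterministic selections. -/

section Derandomization

lemma exists_le_mean {ι : Type*} [Fintype ι] {K : ι → ℝ} (h0 : ∀ i, 0 ≤ K i)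
    (h1 : ∑ i, K i = 1) (f : ι → ℝ) : ∃ i, f i ≤ mean K f := by
  by_contra! h
  have hne : ∃ i ∈ Finset.univ, 0 < K i := by
    by_contra! h'
    have : ∑ i, K i ≤ 0 := Finset.sum_nonpos h'
    linarith
  obtain ⟨i, hi, hK⟩ := hne
  have : mean K (fun _ => mean K f) < mean K f :=
    Finset.sum_lt_sum (fun j _ => mul_le_mul_of_nonneg_left (h j).le (h0 j))
      ⟨i, hi, mul_lt_mul_of_pos_left (h i) hK⟩
  rw [mean_const h1] at this
  exact this.false

/-- Independent random choices can be replaced by deterministic ones that do not cost more. -/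
lemma exists_deterministic_le {S₁ S₂ I₁ I₂ : Type*} [Fintype S₁] [Fintype S₂] [Fintype I₁]
    [Fintype I₂] {K₁ : S₁ → I₁ → ℝ} {K₂ : S₂ → I₂ → ℝ} (h10 : ∀ s i, 0 ≤ K₁ s i)
    (h20 : ∀ s i, 0 ≤ K₂ s i) (h11 : ∀ s, ∑ i, K₁ s i = 1) (h21 : ∀ s, ∑ i, K₂ s i = 1)
    (Φ : S₁ → S₂ → I₁ → I₂ → ℝ) :
    ∃ (g₁ : S₁ → I₁) (g₂ : S₂ → I₂), ∑ s₁, ∑ s₂, Φ s₁ s₂ (g₁ s₁) (g₂ s₂) ≤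
      ∑ s₁, ∑ s₂, mean (K₁ s₁) fun i => mean (K₂ s₂) fun j => Φ s₁ s₂ i j := by
  -- The choice at `s₁` must not depend on `s₂`, so it minimizes the cost summed over `s₂` while the
  -- second terminal still randomizes. Then `g₂` is chosen against the fixed `g₁`.
  choose g₁ hg₁ using fun s₁ => exists_le_mean (h10 s₁) (h11 s₁)
    (fun i => ∑ s₂, mean (K₂ s₂) fun j => Φ s₁ s₂ i j)
  choose g₂ hg₂ using fun s₂ => exists_le_mean (h20 s₂) (h21 s₂)
    (fun j => ∑ s₁, Φ s₁ s₂ (g₁ s₁) j)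
  refine ⟨g₁, g₂, ?_⟩
  calc _ = ∑ s₂, ∑ s₁, Φ s₁ s₂ (g₁ s₁) (g₂ s₂) := Finset.sum_comm
    _ ≤ ∑ s₂, mean (K₂ s₂) fun j => ∑ s₁, Φ s₁ s₂ (g₁ s₁) j :=
        Finset.sum_le_sum fun s₂ _ => hg₂ s₂
    _ = ∑ s₁, ∑ s₂, mean (K₂ s₂) fun j => Φ s₁ s₂ (g₁ s₁) j := by
        simp only [mean_finset_sum]
        exact Finset.sum_comm
    _ ≤ ∑ s₁, mean (K₁ s₁) fun i => ∑ s₂, mean (K₂ s₂) fun j => Φ s₁ s₂ i j :=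
        Finset.sum_le_sum fun s₁ _ => hg₁ s₁
    _ = _ := by simp only [mean_finset_sum]

end Derandomization

/-! ### Composing the two terminals. -/

section TwoTerminals

variable {X₁ U₁ V₁ W₁ X₂ U₂ V₂ W₂ : Type*} [Fintype X₁] [Fintype U₁] [Fintype V₁] [Fintype W₁]
  [Fintype X₂] [Fintype U₂] [Fintype V₂] [Fintype W₂]

/-- The sequence of tuples made of the sequences of both terminals. -/
def zip₈ {n : ℕ} (x₁ : Fin n → X₁) (x₂ : Fin n → X₂)
    (z₁ : (Fin n → U₁) × (Fin n → V₁) × (Fin n → W₁))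
    (z₂ : (Fin n → U₂) × (Fin n → V₂) × (Fin n → W₂)) (t : Fin n) :
    X₁ × X₂ × U₁ × U₂ × V₁ × W₁ × V₂ × W₂ :=
  (x₁ t, x₂ t, z₁.1 t, z₂.1 t, z₁.2.1 t, z₁.2.2 t, z₂.2.1 t, z₂.2.2 t)

/-- Zipping is a bijection. -/
def zip₈Equiv (n : ℕ) (X₁ U₁ V₁ W₁ X₂ U₂ V₂ W₂ : Type*) :
    ((Fin n → X₁) × (Fin n → X₂)) × ((Fin n → U₁) × (Fin n → V₁) × (Fin n → W₁)) ×
      ((Fin n → U₂) × (Fin n → V₂) × (Fin n → W₂)) ≃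
      (Fin n → X₁ × X₂ × U₁ × U₂ × V₁ × W₁ × V₂ × W₂) where
  toFun y := zip₈ y.1.1 y.1.2 y.2.1 y.2.2
  invFun s := ((fun t => (s t).1, fun t => (s t).2.1),
    (fun t => (s t).2.2.1, fun t => (s t).2.2.2.2.1, fun t => (s t).2.2.2.2.2.1),
    (fun t => (s t).2.2.2.1, fun t => (s t).2.2.2.2.2.2.1, fun t => (s t).2.2.2.2.2.2.2))
  left_inv _ := rfl
  right_inv _ := rfl

lemma sum_eq_sum_zip₈ {n : ℕ} (f : (Fin n → X₁ × X₂ × U₁ × U₂ × V₁ × W₁ × V₂ × W₂) → ℝ) :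
    ∑ s, f s = ∑ x₁, ∑ x₂, ∑ z₁, ∑ z₂, f (zip₈ x₁ x₂ z₁ z₂) := by
  rw [← (zip₈Equiv n X₁ U₁ V₁ W₁ X₂ U₂ V₂ W₂).sum_comp, Fintype.sum_prod_type,
    Fintype.sum_prod_type]
  refine Finset.sum_congr rfl fun x₁ _ => Finset.sum_congr rfl fun x₂ _ => ?_
  rw [Fintype.sum_prod_type]
  rfl

/-- Only an inequality, because the conditional law of a null block is identically zero. -/
lemma sum_condLaw_le_one {n : ℕ} {p : X₁ × U₁ × V₁ × W₁ → ℝ} (x : Fin n → X₁) :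
    ∑ z, condLaw p x z ≤ 1 := by
  simp only [condLaw, ← Finset.sum_div, sum_iidLaw_zip₄]
  exact div_self_le_one _

lemma mean_le_one_of_sum_le_one {α : Type*} [Fintype α] {p f : α → ℝ} (hp0 : ∀ a, 0 ≤ p a)
    (hp1 : ∑ a, p a ≤ 1) (hf : ∀ a, f a ≤ 1) : mean p f ≤ 1 :=
  (mean_mono hp0 hf).trans (by simpa [mean] using hp1)

/-- Superposition codebooks of block length `n` and given rates. -/
abbrev RateBook (n : ℕ) (R R₁ R₂ : ℝ) (U V W : Type*) :=
  Book (codebookSize n R) (codebookSize n R₁) (codebookSize n R₂)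
    (Fin n → U) (Fin n → V) (Fin n → W)

/-- Joint covering by two terminals that observe correlated sources: choices of codewords which
depend only on the local source and codebook yield jointly typical tuples. -/
theorem eventually_exists_choices
    {p₁ : X₁ × U₁ × V₁ × W₁ → ℝ} {P₁ : U₁ → ℝ} {q₁₁ : U₁ → V₁ → ℝ} {q₁₂ : U₁ → W₁ → ℝ}
    {p₂ : X₂ × U₂ × V₂ × W₂ → ℝ} {P₂ : U₂ → ℝ} {q₂₁ : U₂ → V₂ → ℝ} {q₂₂ : U₂ → W₂ → ℝ}
    (hp₁ : IsSuperposition p₁ P₁ q₁₁ q₁₂) (hp₂ : IsSuperposition p₂ P₂ q₂₁ q₂₂)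
    {r : X₁ × X₂ → ℝ} (hr0 : ∀ x, 0 ≤ r x)
    (hr₁ : ∀ x₁, ∑ x₂, r (x₁, x₂) = marginal p₁ Prod.fst x₁)
    (hr₂ : ∀ x₂, ∑ x₁, r (x₁, x₂) = marginal p₂ Prod.fst x₂)
    {p : X₁ × X₂ × U₁ × U₂ × V₁ × W₁ × V₂ × W₂ → ℝ} (hp0 : ∀ z, 0 ≤ p z) (hp1 : ∑ z, p z = 1)
    (hp : ∀ x₁ x₂ u₁ u₂ v₁ w₁ v₂ w₂, r (x₁, x₂) * (p₁ (x₁, u₁, v₁, w₁) / marginal p₁ Prod.fst x₁) *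
      (p₂ (x₂, u₂, v₂, w₂) / marginal p₂ Prod.fst x₂) = p (x₁, x₂, u₁, u₂, v₁, w₁, v₂, w₂))
    {R₁ R₁₁ R₁₂ R₂ R₂₁ R₂₂ : ℝ} (hR₁ : 0 ≤ R₁) (hR₁₁ : 0 ≤ R₁₁) (hR₁₂ : 0 ≤ R₁₂)
    (hR₂ : 0 ≤ R₂) (hR₂₁ : 0 ≤ R₂₁) (hR₂₂ : 0 ≤ R₂₂) {Δ : ℝ} (hΔ : 0 < Δ)
    (h₁₀ : mean p₁ (density p₁ fun z => z.2.1) + Δ ≤ R₁)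
    (h₁₁ : mean p₁ (density p₁ fun z => (z.2.1, z.2.2.1)) + Δ ≤ R₁ + R₁₁)
    (h₁₂ : mean p₁ (density p₁ fun z => (z.2.1, z.2.2.2)) + Δ ≤ R₁ + R₁₂)
    (h₁₃ : mean p₁ (density₀ p₁ P₁ q₁₁ q₁₂) + Δ ≤ R₁ + R₁₁ + R₁₂)
    (h₂₀ : mean p₂ (density p₂ fun z => z.2.1) + Δ ≤ R₂)
    (h₂₁ : mean p₂ (density p₂ fun z => (z.2.1, z.2.2.1)) + Δ ≤ R₂ + R₂₁)
    (h₂₂ : mean p₂ (density p₂ fun z => (z.2.1, z.2.2.2)) + Δ ≤ R₂ + R₂₂)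
    (h₂₃ : mean p₂ (density₀ p₂ P₂ q₂₁ q₂₂) + Δ ≤ R₂ + R₂₁ + R₂₂)
    {ε θ : ℝ} (hε : 0 < ε) (hθ : 0 < θ) {B : ∀ n : ℕ,
      (Fin n → X₁ × X₂ × U₁ × U₂ × V₁ × W₁ × V₂ × W₂) → ℝ}
    (hB0 : ∀ n s, 0 ≤ B n s) (hB1 : ∀ n s, B n s ≤ 1)
    (hB : ∀ n s, StronglyTypical ε p s → B n s = 0) :
    ∀ᶠ n : ℕ in atTop, ∃
      (g₁ : RateBook n R₁ R₁₁ R₁₂ U₁ V₁ W₁ × (Fin n → X₁) →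
        Fin (codebookSize n R₁) × Fin (codebookSize n R₁₁) × Fin (codebookSize n R₁₂))
      (g₂ : RateBook n R₂ R₂₁ R₂₂ U₂ V₂ W₂ × (Fin n → X₂) →
        Fin (codebookSize n R₂) × Fin (codebookSize n R₂₁) × Fin (codebookSize n R₂₂)),
      ∑ s₁ : RateBook n R₁ R₁₁ R₁₂ U₁ V₁ W₁ × (Fin n → X₁),
      ∑ s₂ : RateBook n R₂ R₂₁ R₂₂ U₂ V₂ W₂ × (Fin n → X₂),
        bookLaw (iidLaw P₁) (blockKernel q₁₁) (blockKernel q₁₂) s₁.1 *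
        bookLaw (iidLaw P₂) (blockKernel q₂₁) (blockKernel q₂₂) s₂.1 *
        (∏ t, r (s₁.2 t, s₂.2 t)) *
        B n (zip₈ s₁.2 s₂.2 (s₁.1.word (g₁ s₁)) (s₂.1.word (g₂ s₂))) ≤ θ := by
  obtain ⟨c, hc, C, hC⟩ := prob_not_stronglyTypical_le hp0 hp1 hε
  -- Small enough that the exponents `Δ - 3 * γ`, `Δ - 5 * γ` and `c - 4 * γ` are all positive.
  set γ : ℝ := min (Δ / 8) (c / 8) with hγ
  have hγ0 : 0 < γ := by positivity
  have hγΔ : γ ≤ Δ / 8 := min_le_left _ _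
  have hγc : γ ≤ c / 8 := min_le_right _ _
  have hlim : Tendsto (fun n : ℕ => 144 * (2 : ℝ) ^ (-((Δ - 3 * γ) * n)) +
      576 * (2 : ℝ) ^ (-((Δ - 5 * γ) * n)) + 16 * C * (2 : ℝ) ^ (-((c - 4 * γ) * n)))
      atTop (𝓝 0) := by
    have := (((tendsto_two_rpow_neg (c := Δ - 3 * γ) (by linarith)).const_mul 144).add
      ((tendsto_two_rpow_neg (c := Δ - 5 * γ) (by linarith)).const_mul 576)).add
      ((tendsto_two_rpow_neg (c := c - 4 * γ) (by linarith)).const_mul (16 * C))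
    simpa using this
  filter_upwards [eventually_gt_atTop 0, hlim.eventually (ge_mem_nhds (half_pos hθ)),
    hp₁.eventually_exists_block_selection hR₁ hR₁₁ hR₁₂ hγ0 h₁₀ h₁₁ h₁₂ h₁₃
      (θ := θ / 4) (by positivity),
    hp₂.eventually_exists_block_selection hR₂ hR₂₁ hR₂₂ hγ0 h₂₀ h₂₁ h₂₂ h₂₃
      (θ := θ / 4) (by positivity)] with n hn hsmall hsel₁ hsel₂
  obtain ⟨G₁, K₁, hG₁, hK₁0, hK₁1, hK₁⟩ := hsel₁
  obtain ⟨G₂, K₂, hG₂, hK₂0, hK₂1, hK₂⟩ := hsel₂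
  classical
  set L₁ := bookLaw (M := codebookSize n R₁) (M₁ := codebookSize n R₁₁)
    (M₂ := codebookSize n R₁₂) (iidLaw (ι := Fin n) P₁) (blockKernel q₁₁) (blockKernel q₁₂) with hL₁
  set L₂ := bookLaw (M := codebookSize n R₂) (M₁ := codebookSize n R₂₁)
    (M₂ := codebookSize n R₂₂) (iidLaw (ι := Fin n) P₂) (blockKernel q₂₁) (blockKernel q₂₂) with hL₂
  have hL₁0 : ∀ c, 0 ≤ L₁ c := bookLaw_nonneg (iidLaw_nonneg hp₁.law_nonneg)
    (blockKernel_nonneg hp₁.nonneg₁) (blockKernel_nonneg hp₁.nonneg₂)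
  have hL₂0 : ∀ c, 0 ≤ L₂ c := bookLaw_nonneg (iidLaw_nonneg hp₂.law_nonneg)
    (blockKernel_nonneg hp₂.nonneg₁) (blockKernel_nonneg hp₂.nonneg₂)
  have hL₁1 : ∑ c, L₁ c = 1 := sum_bookLaw (sum_iidLaw _ hp₁.sum_law)
    (sum_blockKernel hp₁.sum_eq_one₁) (sum_blockKernel hp₁.sum_eq_one₂)
  have hL₂1 : ∑ c, L₂ c = 1 := sum_bookLaw (sum_iidLaw _ hp₂.sum_law)
    (sum_blockKernel hp₂.sum_eq_one₁) (sum_blockKernel hp₂.sum_eq_one₂)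
  obtain ⟨g₁, g₂, hg⟩ := exists_deterministic_le
    (K₁ := fun s : Book _ _ _ (Fin n → U₁) (Fin n → V₁) (Fin n → W₁) × (Fin n → X₁) => K₁ s.2 s.1)
    (K₂ := fun s : Book _ _ _ (Fin n → U₂) (Fin n → V₂) (Fin n → W₂) × (Fin n → X₂) => K₂ s.2 s.1)
    (fun s => hK₁0 s.2 s.1) (fun s => hK₂0 s.2 s.1) (fun s => hK₁1 s.2 s.1)
    (fun s => hK₂1 s.2 s.1)
    (fun s₁ s₂ i j => L₁ s₁.1 * L₂ s₂.1 * (∏ t, r (s₁.2 t, s₂.2 t)) *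
      B n (zip₈ s₁.2 s₂.2 (s₁.1.word i) (s₂.1.word j)))
  refine ⟨g₁, g₂, hg.trans ?_⟩
  set β : ℝ := 144 * (2 : ℝ) ^ (-((Δ - 3 * γ) * n)) with hβ
  set κ : ℝ := 4 * (2 : ℝ) ^ (n * (2 * γ)) with hκ
  have hβ0 : 0 ≤ β := by positivity
  have hκ0 : 0 ≤ κ := by positivity
  -- `E` is the expected cost of the actual selections given the sources. `D` is the cost when both
  -- triples are drawn from their conditional laws.
  set E : (Fin n → X₁) → (Fin n → X₂) → ℝ := fun x₁ x₂ =>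
    mean L₁ fun c₁ => mean (K₁ x₁ c₁) fun i => mean L₂ fun c₂ => mean (K₂ x₂ c₂) fun j =>
      B n (zip₈ x₁ x₂ (c₁.word i) (c₂.word j)) with hE
  set D : (Fin n → X₁) → (Fin n → X₂) → ℝ := fun x₁ x₂ =>
    mean (condLaw p₁ x₁) fun z₁ => mean (condLaw p₂ x₂) fun z₂ => B n (zip₈ x₁ x₂ z₁ z₂) with hD
  have hcond₁ := fun x : Fin n → X₁ => condLaw_nonneg hp₁.nonneg x
  have hcond₂ := fun x : Fin n → X₂ => condLaw_nonneg hp₂.nonneg x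
  have hD0 : ∀ x₁ x₂, 0 ≤ D x₁ x₂ := fun x₁ x₂ =>
    mean_nonneg (hcond₁ _) fun z₁ => mean_nonneg (hcond₂ _) fun z₂ => hB0 _ _
  have hrn0 : ∀ (x₁ : Fin n → X₁) (x₂ : Fin n → X₂), 0 ≤ ∏ t, r (x₁ t, x₂ t) := fun x₁ x₂ =>
    Finset.prod_nonneg fun t _ => hr0 _
  have hsum : ∑ s₁ : Book _ _ _ (Fin n → U₁) (Fin n → V₁) (Fin n → W₁) × (Fin n → X₁),
      ∑ s₂ : Book _ _ _ (Fin n → U₂) (Fin n → V₂) (Fin n → W₂) × (Fin n → X₂),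
      (mean (K₁ s₁.2 s₁.1) fun i => mean (K₂ s₂.2 s₂.1) fun j =>
        L₁ s₁.1 * L₂ s₂.1 * (∏ t, r (s₁.2 t, s₂.2 t)) *
          B n (zip₈ s₁.2 s₂.2 (s₁.1.word i) (s₂.1.word j))) =
      ∑ x₁, ∑ x₂, (∏ t, r (x₁ t, x₂ t)) * E x₁ x₂ := by
    rw [Fintype.sum_prod_type_right]
    refine Finset.sum_congr rfl fun x₁ _ => ?_
    simp only [Fintype.sum_prod_type_right (α₂ := Fin n → X₂)]
    rw [Finset.sum_comm]
    refine Finset.sum_congr rfl fun x₂ _ => ?_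
    simp only [hE, mean_const_mul]
    have e : ∀ c₁, (mean (K₁ x₁ c₁) fun i => mean L₂ fun c₂ => mean (K₂ x₂ c₂) fun j =>
        B n (zip₈ x₁ x₂ (c₁.word i) (c₂.word j))) = mean L₂ fun c₂ => mean (K₁ x₁ c₁) fun i =>
        mean (K₂ x₂ c₂) fun j => B n (zip₈ x₁ x₂ (c₁.word i) (c₂.word j)) :=
      fun c₁ => mean_comm _ _ _
    simp only [e]
    rw [mean, Finset.mul_sum]
    refine Finset.sum_congr rfl fun c₁ _ => ?_
    rw [mean, Finset.mul_sum, Finset.mul_sum]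
    refine Finset.sum_congr rfl fun c₂ _ => ?_
    ring
  rw [hsum]
  have hbound : ∀ x₁ x₂, E x₁ x₂ ≤ (if ¬ G₁ x₁ then 1 else 0) + (if ¬ G₂ x₂ then 1 else 0) +
      (β + κ * β) + κ ^ 2 * D x₁ x₂ := by
    intro x₁ x₂
    have hrest : 0 ≤ (β + κ * β) + κ ^ 2 * D x₁ x₂ := by
      have := hD0 x₁ x₂
      positivity
    by_cases hx₁ : G₁ x₁
    · by_cases hx₂ : G₂ x₂
      · simp only [hx₁, hx₂, not_true_eq_false, if_false]
        set F : (Fin n → U₁) × (Fin n → V₁) × (Fin n → W₁) → ℝ := fun z₁ =>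
          mean (condLaw p₂ x₂) fun z₂ => B n (zip₈ x₁ x₂ z₁ z₂) with hF
        -- Domination at terminal 2 applies with the triple of terminal 1 frozen. The resulting cost
        -- `F` again takes values in `[0, 1]`, so domination at terminal 1 applies to it.
        have s1 : E x₁ x₂ ≤ mean L₁ fun c₁ => mean (K₁ x₁ c₁) fun i => β + κ * F (c₁.word i) :=
          mean_mono hL₁0 fun c₁ => mean_mono (hK₁0 _ _) fun i =>
            hK₂ x₂ hx₂ (fun z₂ => B n (zip₈ x₁ x₂ (c₁.word i) z₂)) (fun _ => hB0 _ _)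
              (fun _ => hB1 _ _)
        simp only [mean_add, mean_const_mul, mean_const (hK₁1 x₁ _), mean_const hL₁1] at s1
        have s2 := hK₁ x₁ hx₁ F (fun z₁ => mean_nonneg (hcond₂ _) fun z₂ => hB0 _ _)
          (fun z₁ => mean_le_one_of_sum_le_one (hcond₂ _) (sum_condLaw_le_one _) fun z₂ =>
            hB1 _ _)
        have s3 := mul_le_mul_of_nonneg_left s2 hκ0
        have s4 : D x₁ x₂ = mean (condLaw p₁ x₁) F := rfl
        rw [s4]
        linarith
      · have s1 : E x₁ x₂ ≤ 1 := mean_le_one hL₁0 hL₁1 fun c₁ =>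
          mean_le_one (hK₁0 _ _) (hK₁1 _ _) fun i => mean_le_one hL₂0 hL₂1 fun c₂ =>
          mean_le_one (hK₂0 _ _) (hK₂1 _ _) fun j => hB1 _ _
        simp only [hx₁, hx₂, not_true_eq_false, not_false_eq_true, if_false, if_true]
        linarith
    · have s1 : E x₁ x₂ ≤ 1 := mean_le_one hL₁0 hL₁1 fun c₁ =>
        mean_le_one (hK₁0 _ _) (hK₁1 _ _) fun i => mean_le_one hL₂0 hL₂1 fun c₂ =>
        mean_le_one (hK₂0 _ _) (hK₂1 _ _) fun j => hB1 _ _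
      simp only [hx₁, not_false_eq_true, if_true]
      have : (0 : ℝ) ≤ if ¬ G₂ x₂ then 1 else 0 := by positivity
      linarith
  have hm₁ : ∀ x₁ : Fin n → X₁, ∑ x₂ : Fin n → X₂, ∏ t, r (x₁ t, x₂ t) =
      iidLaw (marginal p₁ Prod.fst) x₁ := fun x₁ => by
    simp only [iidLaw, ← hr₁]
    exact sum_prod_pi fun t x₂ => r (x₁ t, x₂)
  have hm₂ : ∀ x₂ : Fin n → X₂, ∑ x₁ : Fin n → X₁, ∏ t, r (x₁ t, x₂ t) =
      iidLaw (marginal p₂ Prod.fst) x₂ := fun x₂ => by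
    simp only [iidLaw, ← hr₂]
    exact sum_prod_pi fun t x₁ => r (x₁, x₂ t)
  have t₁ : ∑ x₁ : Fin n → X₁, ∑ x₂ : Fin n → X₂, (∏ t, r (x₁ t, x₂ t)) *
      (if ¬ G₁ x₁ then (1 : ℝ) else 0) ≤ θ / 4 := by
    simp only [← Finset.sum_mul, hm₁]
    refine le_trans (le_of_eq ?_) hG₁
    simp only [prob, mean]
    congr!
  have t₂ : ∑ x₁ : Fin n → X₁, ∑ x₂ : Fin n → X₂, (∏ t, r (x₁ t, x₂ t)) *
      (if ¬ G₂ x₂ then (1 : ℝ) else 0) ≤ θ / 4 := by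
    rw [Finset.sum_comm]
    simp only [← Finset.sum_mul, hm₂]
    refine le_trans (le_of_eq ?_) hG₂
    simp only [prob, mean]
    congr!
  have t₃ : ∑ x₁ : Fin n → X₁, ∑ x₂ : Fin n → X₂, (∏ t, r (x₁ t, x₂ t)) * (β + κ * β) =
      β + κ * β := by
    simp only [← Finset.sum_mul, hm₁]
    rw [sum_iidLaw _ (sum_marginal hp₁.sum_eq_one _), one_mul]
  -- The factorization `hp`, which encodes the Markov condition, identifies the law behind `D` as
  -- the true i.i.d. joint law, where Chernoff applies.
  have hfac : ∀ (x₁ : Fin n → X₁) (x₂ : Fin n → X₂) z₁ z₂,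
      (∏ t, r (x₁ t, x₂ t)) * (condLaw p₁ x₁ z₁ * condLaw p₂ x₂ z₂) =
        iidLaw p (zip₈ x₁ x₂ z₁ z₂) := by
    intro x₁ x₂ z₁ z₂
    simp only [condLaw, iidLaw, ← Finset.prod_div_distrib, ← Finset.prod_mul_distrib, ← mul_assoc]
    exact Finset.prod_congr rfl fun t _ => hp _ _ _ _ _ _ _ _
  have t₄ : ∑ x₁ : Fin n → X₁, ∑ x₂ : Fin n → X₂, (∏ t, r (x₁ t, x₂ t)) * D x₁ x₂ ≤
      C * (2 : ℝ) ^ (-(c * n)) := by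
    refine le_trans ?_ (hC n hn)
    unfold prob
    calc _ = ∑ x₁ : Fin n → X₁, ∑ x₂ : Fin n → X₂, ∑ z₁, ∑ z₂,
          iidLaw p (zip₈ x₁ x₂ z₁ z₂) * B n (zip₈ x₁ x₂ z₁ z₂) := by
          simp only [hD, mean, Finset.mul_sum, ← hfac, mul_assoc]
      _ = mean (iidLaw p) (B n) := (sum_eq_sum_zip₈ fun s => iidLaw p s * B n s).symm
      _ ≤ _ := by
          refine mean_mono (iidLaw_nonneg hp0) fun s => ?_
          by_cases hs : StronglyTypical ε p s
          · simp [hs, hB n s hs]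
          · simp [hs, hB1]
  calc _ ≤ ∑ x₁ : Fin n → X₁, ∑ x₂ : Fin n → X₂, (∏ t, r (x₁ t, x₂ t)) *
        ((if ¬ G₁ x₁ then 1 else 0) + (if ¬ G₂ x₂ then 1 else 0) +
        (β + κ * β) + κ ^ 2 * D x₁ x₂) :=
        Finset.sum_le_sum fun x₁ _ => Finset.sum_le_sum fun x₂ _ =>
          mul_le_mul_of_nonneg_left (hbound x₁ x₂) (hrn0 x₁ x₂)
    _ = (∑ x₁ : Fin n → X₁, ∑ x₂ : Fin n → X₂, (∏ t, r (x₁ t, x₂ t)) *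
          (if ¬ G₁ x₁ then (1 : ℝ) else 0)) + (∑ x₁ : Fin n → X₁, ∑ x₂ : Fin n → X₂,
          (∏ t, r (x₁ t, x₂ t)) * (if ¬ G₂ x₂ then (1 : ℝ) else 0)) +
        (∑ x₁ : Fin n → X₁, ∑ x₂ : Fin n → X₂, (∏ t, r (x₁ t, x₂ t)) * (β + κ * β)) +
        κ ^ 2 * ∑ x₁ : Fin n → X₁, ∑ x₂ : Fin n → X₂, (∏ t, r (x₁ t, x₂ t)) * D x₁ x₂ := by
        simp only [Finset.mul_sum, ← Finset.sum_add_distrib]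
        refine Finset.sum_congr rfl fun x₁ _ => Finset.sum_congr rfl fun x₂ _ => ?_
        ring
    _ ≤ θ / 4 + θ / 4 + (β + κ * β) + κ ^ 2 * (C * (2 : ℝ) ^ (-(c * n))) := by
        rw [t₃]
        gcongr
    -- The constants are `576 = 4 * 144` from `κ * β` and `16 = 4 ^ 2` from `κ ^ 2`.
    _ = θ / 2 + (144 * (2 : ℝ) ^ (-((Δ - 3 * γ) * n)) +
      576 * (2 : ℝ) ^ (-((Δ - 5 * γ) * n)) + 16 * C * (2 : ℝ) ^ (-((c - 4 * γ) * n))) := by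
        have two : (0 : ℝ) < 2 := by norm_num
        have e₁ : (2 : ℝ) ^ (-((Δ - 5 * γ) * n)) =
            2 ^ (n * (2 * γ)) * 2 ^ (-((Δ - 3 * γ) * n)) := by
          rw [← Real.rpow_add two]
          congr 1
          ring
        have e₂ : (2 : ℝ) ^ (-((c - 4 * γ) * n)) =
            2 ^ (n * (2 * γ)) * 2 ^ (n * (2 * γ)) * 2 ^ (-(c * n)) := by
          rw [← Real.rpow_add two, ← Real.rpow_add two]
          congr 1
          ring
        rw [e₁, e₂, hβ, hκ]
        ring
    _ ≤ θ := by linarith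

end TwoTerminals

/-! ### From random variables to mass functions. -/

section MassFunctions

variable {Ω : Type*} [MeasurableSpace Ω] {μ : Measure Ω}

lemma pmf_nonneg {α : Type*} (Z : Ω → α) (a : α) : 0 ≤ pmf μ Z a := measureReal_nonneg

lemma pmf_comp [IsFiniteMeasure μ] {α β : Type*} [Fintype α] {Z : Ω → α}
    (hZ : Measurable[_, ⊤] Z) (f : α → β) (b : β) :
    pmf μ (fun ω => f (Z ω)) b = marginal (pmf μ Z) f b := by
  classical
  have e : (fun ω => f (Z ω)) ⁻¹' {b} = ⋃ a ∈ Finset.univ.filter (fun a => f a = b), Z ⁻¹' {a} := by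
    ext ω
    simp
  unfold pmf marginal
  rw [e, measureReal_biUnion_finset, Finset.sum_filter]
  · intro a _ a' _ haa'
    exact Disjoint.preimage _ (by simpa using haa')
  · intro a _
    exact hZ trivial

lemma sum_pmf [IsProbabilityMeasure μ] {α : Type*} [Fintype α] {Z : Ω → α}
    (hZ : Measurable[_, ⊤] Z) : ∑ a, pmf μ Z a = 1 := by
  have := pmf_comp (μ := μ) hZ (fun _ => ()) ()
  simp only [marginal, if_true] at this
  rw [← this]
  simp [pmf]

/-- Finiteness gives `⊤` on the product: every set is a countable union of points, and the preimage
of a point is an intersection of two fibres. -/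
lemma measurable_prodMk_top {α β : Type*} [Finite α] [Finite β] {Y : Ω → α} {Z : Ω → β}
    (hY : Measurable[_, ⊤] Y) (hZ : Measurable[_, ⊤] Z) :
    Measurable[_, ⊤] fun ω => (Y ω, Z ω) := by
  intro s _
  have e : (fun ω => (Y ω, Z ω)) ⁻¹' s = ⋃ z ∈ s, Y ⁻¹' {z.1} ∩ Z ⁻¹' {z.2} := by
    ext ω
    simp only [Set.mem_preimage, Set.mem_iUnion, Set.mem_inter_iff, Set.mem_singleton_iff]
    constructor
    · intro h
      exact ⟨_, h, rfl, rfl⟩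
    · rintro ⟨z, hz, h1, h2⟩
      rwa [h1, h2]
  rw [e]
  exact MeasurableSet.biUnion (Set.to_countable s) fun z _ =>
    (hY trivial).inter (hZ trivial)

/-- Writing all entropies as means under the law of one common variable turns information identities
into linear identities between logarithms. -/
lemma entropy_comp [IsFiniteMeasure μ] {α β : Type*} [Fintype α] [Fintype β] {Z : Ω → α}
    (hZ : Measurable[_, ⊤] Z) (f : α → β) :
    entropy μ (fun ω => f (Z ω)) =
      - mean (pmf μ Z) fun a => Real.logb 2 (marginal (pmf μ Z) f (f a)) := by
  unfold entropy
  simp only [pmf_comp hZ]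
  exact congrArg _ (mean_marginal (pmf μ Z) f fun b => Real.logb 2 (marginal (pmf μ Z) f b))

lemma marginal_comp_injective {α β γ : Type*} [Fintype α] (p : α → ℝ) (f : α → β) {e : β → γ}
    (he : Function.Injective e) (b : β) :
    marginal p (fun a => e (f a)) (e b) = marginal p f b := by
  classical
  simp only [marginal, he.eq_iff]

lemma entropy_comp_injective [IsFiniteMeasure μ] {α β γ : Type*} [Fintype α] [Fintype β]
    [Fintype γ] {Z : Ω → α} (hZ : Measurable[_, ⊤] Z) (f : α → β) {e : β → γ}
    (he : Function.Injective e) :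
    entropy μ (fun ω => e (f (Z ω))) = entropy μ (fun ω => f (Z ω)) := by
  rw [entropy_comp hZ (fun a => e (f a)), entropy_comp hZ f]
  simp only [marginal_comp_injective _ f he]

lemma marginal_id {α : Type*} [Fintype α] (p : α → ℝ) (a : α) : marginal p (fun a => a) a = p a := by
  classical
  simp [marginal]

open Classical in
/-- The conditional mass function of `V` given `U`, completed by the law of `V` on null events. -/
def kernelPmf {α β : Type*} (μ : Measure Ω) (V : Ω → β) (U : Ω → α) (u : α) (v : β) : ℝ :=
  if pmf μ U u = 0 then pmf μ V v else condPmf μ V U v u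

lemma kernelPmf_nonneg {α β : Type*} (V : Ω → β) (U : Ω → α) (u : α) (v : β) :
    0 ≤ kernelPmf μ V U u v := by
  unfold kernelPmf
  split_ifs
  · exact pmf_nonneg _ _
  · exact div_nonneg (pmf_nonneg _ _) (pmf_nonneg _ _)

lemma sum_pmf_prodMk [IsFiniteMeasure μ] {α β : Type*} [Fintype α] [Fintype β] {U : Ω → α}
    {V : Ω → β} (hU : Measurable[_, ⊤] U) (hV : Measurable[_, ⊤] V) (u : α) :
    ∑ v, pmf μ (fun ω => (U ω, V ω)) (u, v) = pmf μ U u := by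
  classical
  have := pmf_comp (μ := μ) (measurable_prodMk_top hU hV) Prod.fst u
  simp only [marginal] at this
  rw [this, Fintype.sum_prod_type, Finset.sum_eq_single u (fun y _ hy => by simp [hy]) (by simp)]
  simp

lemma pmf_mul_kernelPmf [IsFiniteMeasure μ] {α β : Type*} [Fintype α] [Fintype β] {U : Ω → α}
    {V : Ω → β} (hU : Measurable[_, ⊤] U) (hV : Measurable[_, ⊤] V) (u : α) (v : β) :
    pmf μ U u * kernelPmf μ V U u v = pmf μ (fun ω => (U ω, V ω)) (u, v) := by
  unfold kernelPmf
  split_ifs with h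
  · rw [h, zero_mul]
    rw [← sum_pmf_prodMk hU hV] at h
    exact ((Finset.sum_eq_zero_iff_of_nonneg fun v _ => pmf_nonneg _ _).1 h v
      (Finset.mem_univ v)).symm
  · exact mul_div_cancel₀ _ h

lemma sum_kernelPmf [IsProbabilityMeasure μ] {α β : Type*} [Fintype α] [Fintype β] {U : Ω → α}
    {V : Ω → β} (hU : Measurable[_, ⊤] U) (hV : Measurable[_, ⊤] V) (u : α) :
    ∑ v, kernelPmf μ V U u v = 1 := by
  unfold kernelPmf
  split_ifs with h
  · exact sum_pmf hV
  · simp only [condPmf]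
    rw [← Finset.sum_div, sum_pmf_prodMk hU hV, div_self h]

/-- `condPmf` vanishes on null letters and is no kernel there, whereas the covering argument needs
every row to sum to one. Completing it changes only factors multiplied by a zero codeword
probability. -/
lemma codebookProb_eq_bookLaw {𝒰 𝒱₁ 𝒱₂ : Type*} (U : Ω → 𝒰) (V₁ : Ω → 𝒱₁) (V₂ : Ω → 𝒱₂)
    {n M M₁ M₂ : ℕ} (c : Codebook n M M₁ M₂ 𝒰 𝒱₁ 𝒱₂) :
    codebookProb μ U V₁ V₂ c = bookLaw (iidLaw (pmf μ U)) (blockKernel (kernelPmf μ V₁ U))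
      (blockKernel (kernelPmf μ V₂ U)) c := by
  unfold codebookProb bookLaw clusterLaw iidLaw blockKernel
  refine Finset.prod_congr rfl fun i _ => ?_
  rw [mul_assoc]
  by_cases h : ∏ t, pmf μ U (c.1 i t) = 0
  · simp only [h, zero_mul]
  · have h' : ∀ t, pmf μ U (c.1 i t) ≠ 0 := fun t ht => h (Finset.prod_eq_zero (Finset.mem_univ t) ht)
    simp only [kernelPmf, h', if_false]

end MassFunctions

/-! ### Information quantities as means of information densities. -/

section Information

variable {Ω X U V W : Type*} [MeasurableSpace Ω] {μ : Measure Ω} [IsProbabilityMeasure μ]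
  [Fintype X] [Fintype U] [Fintype V] [Fintype W]
  {Xv : Ω → X} {Uv : Ω → U} {Vv : Ω → V} {Wv : Ω → W}

/-- The mass functions of a codeword letter and its satellites. -/
lemma isSuperposition_pmf (hX : Measurable[_, ⊤] Xv) (hU : Measurable[_, ⊤] Uv)
    (hV : Measurable[_, ⊤] Vv) (hW : Measurable[_, ⊤] Wv) :
    IsSuperposition (pmf μ fun ω => (Xv ω, Uv ω, Vv ω, Wv ω)) (pmf μ Uv) (kernelPmf μ Vv Uv)
      (kernelPmf μ Wv Uv) :=
  have hZ := measurable_prodMk_top hX (measurable_prodMk_top hU (measurable_prodMk_top hV hW))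
  { nonneg := pmf_nonneg _
    sum_eq_one := sum_pmf hZ
    marginal_eq := fun u => (pmf_comp hZ (fun z => z.2.1) u).symm
    nonneg₁ := kernelPmf_nonneg _ _
    nonneg₂ := kernelPmf_nonneg _ _
    sum_eq_one₁ := sum_kernelPmf hU hV
    sum_eq_one₂ := sum_kernelPmf hU hW
    marginal_eq₁ := fun u v => (pmf_comp hZ (fun z => (z.2.1, z.2.2.1)) (u, v)).symm.trans
      (pmf_mul_kernelPmf hU hV u v).symm
    marginal_eq₂ := fun u w => (pmf_comp hZ (fun z => (z.2.1, z.2.2.2)) (u, w)).symm.trans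
      (pmf_mul_kernelPmf hU hW u w).symm }

lemma mean_congr_support {α : Type*} [Fintype α] {p f g : α → ℝ}
    (h : ∀ a, p a ≠ 0 → f a = g a) : mean p f = mean p g := by
  refine Finset.sum_congr rfl fun a _ => ?_
  by_cases ha : p a = 0
  · simp [ha]
  · rw [h a ha]

lemma mutualInfo_eq_mean_density {Z : Ω → X × U × V × W} (hZ : Measurable[_, ⊤] Z) {Y : Type*}
    [Fintype Y] (f : X × U × V × W → Y) :
    mutualInfo μ (fun ω => (Z ω).1) (fun ω => f (Z ω)) = mean (pmf μ Z) (density (pmf μ Z) f) := by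
  have hp : ∀ z, 0 ≤ pmf μ Z z := pmf_nonneg Z
  have e : mean (pmf μ Z) (density (pmf μ Z) f) = mean (pmf μ Z) fun z =>
      Real.logb 2 (marginal (pmf μ Z) (fun z => (z.1, f z)) (z.1, f z)) +
      ((-1) * Real.logb 2 (marginal (pmf μ Z) Prod.fst z.1) +
      (-1) * Real.logb 2 (marginal (pmf μ Z) f (f z))) := by
    refine mean_congr_support fun z hz => ?_
    have h1 := (marginal_pos hp (fun z => (z.1, f z)) hz).ne'
    have h2 := (marginal_pos hp Prod.fst hz).ne'
    have h3 := (marginal_pos hp f hz).ne'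
    unfold density
    rw [Real.logb_div h1 (mul_ne_zero h2 h3), Real.logb_mul h2 h3]
    ring
  rw [e, mean_add, mean_add, mean_const_mul, mean_const_mul]
  unfold mutualInfo condEntropy
  rw [entropy_comp hZ f, entropy_comp hZ Prod.fst, entropy_comp hZ (fun z => (z.1, f z))]
  ring

lemma mutualInfo_comp_injective {Z : Ω → X × U × V × W} (hZ : Measurable[_, ⊤] Z) {Y Y' : Type*}
    [Fintype Y] [Fintype Y'] (f : X × U × V × W → Y) {e : Y → Y'} (he : Function.Injective e) :
    mutualInfo μ (fun ω => (Z ω).1) (fun ω => e (f (Z ω))) =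
      mutualInfo μ (fun ω => (Z ω).1) (fun ω => f (Z ω)) := by
  unfold mutualInfo condEntropy
  rw [entropy_comp_injective hZ f he, entropy_comp_injective hZ (fun z => (z.1, f z))
    (e := fun z => (z.1, e z.2)) (fun a b hab => Prod.ext (Prod.mk.inj hab).1
      (he (Prod.mk.inj hab).2))]

lemma swap_injective {α β : Type*} : Function.Injective fun z : α × β => (z.2, z.1) :=
  Prod.swap_injective

/-- Both sides equal `H(X) + H(U,V) + H(U,W) - H(U) - H(X,U,V,W)`. On the left the entropy of
`(U,V,W)` cancels. -/
lemma mean_density₀ (hX : Measurable[_, ⊤] Xv) (hU : Measurable[_, ⊤] Uv)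
    (hV : Measurable[_, ⊤] Vv) (hW : Measurable[_, ⊤] Wv) :
    mutualInfo μ Xv (fun ω => (Vv ω, Wv ω, Uv ω)) + condMutualInfo μ Vv Wv Uv =
      mean (pmf μ fun ω => (Xv ω, Uv ω, Vv ω, Wv ω)) (density₀ (pmf μ fun ω => (Xv ω, Uv ω, Vv ω, Wv ω))
        (pmf μ Uv) (kernelPmf μ Vv Uv) (kernelPmf μ Wv Uv)) := by
  have hZ := measurable_prodMk_top hX (measurable_prodMk_top hU (measurable_prodMk_top hV hW))
  have hS := isSuperposition_pmf (μ := μ) hX hU hV hW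
  set Z : Ω → X × U × V × W := fun ω => (Xv ω, Uv ω, Vv ω, Wv ω) with hZdef
  set p := pmf μ Z with hp
  have e : mean p (density₀ p (pmf μ Uv) (kernelPmf μ Vv Uv) (kernelPmf μ Wv Uv)) = mean p fun z =>
      Real.logb 2 (marginal p (fun z => z) z) +
      ((-1) * Real.logb 2 (marginal p Prod.fst z.1) +
      (Real.logb 2 (marginal p (fun z => z.2.1) z.2.1) +
      ((-1) * Real.logb 2 (marginal p (fun z => (z.2.1, z.2.2.1)) (z.2.1, z.2.2.1)) +
      (-1) * Real.logb 2 (marginal p (fun z => (z.2.1, z.2.2.2)) (z.2.1, z.2.2.2))))) := by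
    refine mean_congr_support fun z hz => ?_
    have h2 := (marginal_pos hS.nonneg Prod.fst hz).ne'
    have h3 := (marginal_pos hS.nonneg (fun z => z.2.1) hz).ne'
    have h4 := (marginal_pos hS.nonneg (fun z => (z.2.1, z.2.2.1)) hz).ne'
    have h5 := (marginal_pos hS.nonneg (fun z => (z.2.1, z.2.2.2)) hz).ne'
    rw [marginal_id]
    simp only [hS.marginal_eq, hS.marginal_eq₁, hS.marginal_eq₂] at h3 h4 h5 ⊢
    have h6 := right_ne_zero_of_mul h4
    have h7 := right_ne_zero_of_mul h5
    unfold density₀ tripleLaw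
    rw [Real.logb_div hz (mul_ne_zero h2 (mul_ne_zero h3 (mul_ne_zero h6 h7))),
      Real.logb_mul h2 (mul_ne_zero h3 (mul_ne_zero h6 h7)), Real.logb_mul h3 (mul_ne_zero h6 h7),
      Real.logb_mul h6 h7, Real.logb_mul h3 h6, Real.logb_mul h3 h7]
    ring
  rw [e, mean_add, mean_add, mean_add, mean_add, mean_const_mul, mean_const_mul, mean_const_mul]
  have i₁ := entropy_comp (μ := μ) hZ (fun z => z)
  have i₂ := entropy_comp (μ := μ) hZ Prod.fst
  have i₃ := entropy_comp (μ := μ) hZ (fun z => z.2.1)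
  have i₄ := entropy_comp (μ := μ) hZ (fun z => (z.2.1, z.2.2.1))
  have i₅ := entropy_comp (μ := μ) hZ (fun z => (z.2.1, z.2.2.2))
  have j₁ := entropy_comp_injective (μ := μ) hZ (fun z => z)
    (e := fun z => (z.1, z.2.2.1, z.2.2.2, z.2.1)) (fun a b hab => by
      simp only [Prod.mk.injEq] at hab
      ext <;> simp [hab])
  have j₂ := entropy_comp_injective (μ := μ) hZ (fun z => (z.2.1, z.2.2.1)) swap_injective
  have j₃ := entropy_comp_injective (μ := μ) hZ (fun z => (z.2.1, z.2.2.2)) swap_injective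
  simp only [hZdef] at i₁ i₂ i₃ i₄ i₅ j₁ j₂ j₃
  unfold mutualInfo condMutualInfo condEntropy
  rw [j₁, j₂, j₃]
  rw [← hZdef, ← hp] at *
  linarith

lemma mutualInfo_codeword (hX : Measurable[_, ⊤] Xv) (hU : Measurable[_, ⊤] Uv)
    (hV : Measurable[_, ⊤] Vv) (hW : Measurable[_, ⊤] Wv) :
    mutualInfo μ Xv Uv = mean (pmf μ fun ω => (Xv ω, Uv ω, Vv ω, Wv ω))
      (density (pmf μ fun ω => (Xv ω, Uv ω, Vv ω, Wv ω)) fun z => z.2.1) :=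
  have hZ := measurable_prodMk_top hX (measurable_prodMk_top hU (measurable_prodMk_top hV hW))
  mutualInfo_eq_mean_density hZ (fun z => z.2.1)

lemma mutualInfo_satellite₁ (hX : Measurable[_, ⊤] Xv) (hU : Measurable[_, ⊤] Uv)
    (hV : Measurable[_, ⊤] Vv) (hW : Measurable[_, ⊤] Wv) :
    mutualInfo μ Xv (fun ω => (Vv ω, Uv ω)) = mean (pmf μ fun ω => (Xv ω, Uv ω, Vv ω, Wv ω))
      (density (pmf μ fun ω => (Xv ω, Uv ω, Vv ω, Wv ω)) fun z => (z.2.1, z.2.2.1)) := by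
  have hZ := measurable_prodMk_top hX (measurable_prodMk_top hU (measurable_prodMk_top hV hW))
  rw [← mutualInfo_eq_mean_density hZ (fun z => (z.2.1, z.2.2.1))]
  have hs : Function.Injective fun z : U × V => (z.2, z.1) := swap_injective
  exact mutualInfo_comp_injective hZ (fun z => (z.2.1, z.2.2.1)) (e := fun z : U × V => (z.2, z.1)) hs

lemma mutualInfo_satellite₂ (hX : Measurable[_, ⊤] Xv) (hU : Measurable[_, ⊤] Uv)
    (hV : Measurable[_, ⊤] Vv) (hW : Measurable[_, ⊤] Wv) :
    mutualInfo μ Xv (fun ω => (Wv ω, Uv ω)) = mean (pmf μ fun ω => (Xv ω, Uv ω, Vv ω, Wv ω))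
      (density (pmf μ fun ω => (Xv ω, Uv ω, Vv ω, Wv ω)) fun z => (z.2.1, z.2.2.2)) := by
  have hZ := measurable_prodMk_top hX (measurable_prodMk_top hU (measurable_prodMk_top hV hW))
  rw [← mutualInfo_eq_mean_density hZ (fun z => (z.2.1, z.2.2.2))]
  have hs : Function.Injective fun z : U × W => (z.2, z.1) := swap_injective
  exact mutualInfo_comp_injective hZ (fun z => (z.2.1, z.2.2.2)) (e := fun z : U × W => (z.2, z.1)) hs

end Information

/-! ### Factorization along the Markov chain. -/

section Markov

variable {Ω : Type*} [MeasurableSpace Ω] {μ : Measure Ω}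

lemma pmf_congr {α β : Type*} {Y : Ω → α} {Z : Ω → β} {a : α} {b : β}
    (h : ∀ ω, Y ω = a ↔ Z ω = b) : pmf μ Y a = pmf μ Z b :=
  congrArg μ.real (Set.ext h)

lemma pmf_eq_zero_of_imp [IsFiniteMeasure μ] {α β : Type*} {Y : Ω → α} {Z : Ω → β} {a : α} {b : β}
    (h : ∀ ω, Y ω = a → Z ω = b) (hb : pmf μ Z b = 0) : pmf μ Y a = 0 :=
  le_antisymm (hb ▸ measureReal_mono (fun ω hω => h ω hω)) (pmf_nonneg _ _)

/-- Factorization of the joint mass function of a four-term Markov chain. -/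
lemma MarkovChain₄.pmf_eq [IsProbabilityMeasure μ] {α β γ κ : Type*} [Fintype α] [Fintype β]
    [Fintype γ] [Fintype κ] {A : Ω → α} {X : Ω → β} {Y : Ω → γ} {B : Ω → κ}
    (hA : Measurable[_, ⊤] A) (hX : Measurable[_, ⊤] X) (hY : Measurable[_, ⊤] Y)
    (hB : Measurable[_, ⊤] B) (h : MarkovChain₄ μ A X Y B) (a : α) (x : β) (y : γ) (b : κ) :
    pmf μ (fun ω => (X ω, Y ω)) (x, y) * (pmf μ (fun ω => (X ω, A ω)) (x, a) / pmf μ X x) *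
      (pmf μ (fun ω => (Y ω, B ω)) (y, b) / pmf μ Y y) =
      pmf μ (fun ω => (A ω, X ω, Y ω, B ω)) (a, x, y, b) := by
  have hXY := measurable_prodMk_top hX hY
  have e₁ := h.1 a x (y, b)
  -- Summing the second Markov relation over `a` leaves the chain `X ↔ Y ↔ B`.
  have e₂ : pmf μ (fun ω => (X ω, Y ω, B ω)) (x, y, b) * pmf μ Y y =
      pmf μ (fun ω => (X ω, Y ω)) (x, y) * pmf μ (fun ω => (Y ω, B ω)) (y, b) := by
    rw [← sum_pmf_prodMk (measurable_prodMk_top hX (measurable_prodMk_top hY hB)) hA,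
      ← sum_pmf_prodMk hXY hA, Finset.sum_mul, Finset.sum_mul]
    refine Finset.sum_congr rfl fun a _ => ?_
    have := h.2 (a, x) y b
    rw [pmf_congr (Z := fun ω => ((A ω, X ω), Y ω, B ω)) (b := ((a, x), y, b)) (by
      intro ω; simp only [Prod.mk.injEq]; tauto),
      pmf_congr (Y := fun ω => ((X ω, Y ω), A ω)) (Z := fun ω => ((A ω, X ω), Y ω))
        (b := ((a, x), y)) (by intro ω; simp only [Prod.mk.injEq]; tauto)]
    exact this
  -- At a null `x` or `y` division by zero makes the left side zero, and the joint probability is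
  -- zero as well.
  by_cases hx : pmf μ X x = 0
  · rw [hx, div_zero, mul_zero, zero_mul]
    exact (pmf_eq_zero_of_imp (fun ω hω => (Prod.mk.inj (Prod.mk.inj hω).2).1) hx).symm
  by_cases hy : pmf μ Y y = 0
  · rw [hy, div_zero, mul_zero]
    exact (pmf_eq_zero_of_imp (fun ω hω => by
      simp only [Prod.mk.injEq] at hω; exact hω.2.2.1) hy).symm
  have e₃ : pmf μ (fun ω => (X ω, A ω)) (x, a) = pmf μ (fun ω => (A ω, X ω)) (a, x) :=
    pmf_congr fun ω => by simp only [Prod.mk.injEq]; tauto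
  rw [e₃]
  field_simp
  rw [mul_right_comm, ← e₂]
  linear_combination (- pmf μ Y y) * e₁

end Markov

end MutualCovering

end

/-! ### Success probability and the main theorem. -/

open MutualCovering

open Classical in
/-- The success probability as one minus a failure probability. -/
lemma MutualCovering.one_sub_le_successProb
    {Ω 𝒳₁ 𝒳₂ 𝒰₁ 𝒰₂ 𝒰₁₁ 𝒰₁₂ 𝒰₂₁ 𝒰₂₂ : Type*} [MeasurableSpace Ω]
    [Fintype 𝒳₁] [Fintype 𝒳₂] [Fintype 𝒰₁] [Fintype 𝒰₂]
    [Fintype 𝒰₁₁] [Fintype 𝒰₁₂] [Fintype 𝒰₂₁] [Fintype 𝒰₂₂]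
    {μ : Measure Ω} [IsProbabilityMeasure μ]
    {X₁ : Ω → 𝒳₁} {X₂ : Ω → 𝒳₂} {U₁ : Ω → 𝒰₁} {U₂ : Ω → 𝒰₂}
    {U₁₁ : Ω → 𝒰₁₁} {U₁₂ : Ω → 𝒰₁₂} {U₂₁ : Ω → 𝒰₂₁} {U₂₂ : Ω → 𝒰₂₂}
    (hX₁ : Measurable[_, ⊤] X₁) (hX₂ : Measurable[_, ⊤] X₂)
    (hU₁ : Measurable[_, ⊤] U₁) (hU₂ : Measurable[_, ⊤] U₂)
    (hU₁₁ : Measurable[_, ⊤] U₁₁) (hU₁₂ : Measurable[_, ⊤] U₁₂)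
    (hU₂₁ : Measurable[_, ⊤] U₂₁) (hU₂₂ : Measurable[_, ⊤] U₂₂)
    {n M₁ M₁₁ M₁₂ M₂ M₂₁ M₂₂ : ℕ} {ε θ : ℝ}
    (g₁ : Codebook n M₁ M₁₁ M₁₂ 𝒰₁ 𝒰₁₁ 𝒰₁₂ × (Fin n → 𝒳₁) → Fin M₁ × Fin M₁₁ × Fin M₁₂)
    (g₂ : Codebook n M₂ M₂₁ M₂₂ 𝒰₂ 𝒰₂₁ 𝒰₂₂ × (Fin n → 𝒳₂) → Fin M₂ × Fin M₂₁ × Fin M₂₂)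
    (h : ∑ s₁ : Codebook n M₁ M₁₁ M₁₂ 𝒰₁ 𝒰₁₁ 𝒰₁₂ × (Fin n → 𝒳₁),
      ∑ s₂ : Codebook n M₂ M₂₁ M₂₂ 𝒰₂ 𝒰₂₁ 𝒰₂₂ × (Fin n → 𝒳₂),
      codebookProb μ U₁ U₁₁ U₁₂ s₁.1 * codebookProb μ U₂ U₂₁ U₂₂ s₂.1 *
        (∏ t, pmf μ (fun ω => (X₁ ω, X₂ ω)) (s₁.2 t, s₂.2 t)) *
        (if StronglyTypical ε
            (pmf μ fun ω => (X₁ ω, X₂ ω, U₁ ω, U₂ ω, U₁₁ ω, U₁₂ ω, U₂₁ ω, U₂₂ ω))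
            (zip₈ s₁.2 s₂.2 (Book.word s₁.1 (g₁ s₁)) (Book.word s₂.1 (g₂ s₂))) then 0 else 1) ≤ θ) :
    1 - θ ≤ successProb μ X₁ X₂ U₁ U₂ U₁₁ U₁₂ U₂₁ U₂₂ ε
      (fun c => ⟨fun x => (Book.word c (g₁ (c, x))).1, fun x _ => (Book.word c (g₁ (c, x))).2.1,
        fun x _ => (Book.word c (g₁ (c, x))).2.2⟩)
      (fun c => ⟨fun x => (Book.word c (g₂ (c, x))).1, fun x _ => (Book.word c (g₂ (c, x))).2.1,
        fun x _ => (Book.word c (g₂ (c, x))).2.2⟩) := by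
  have hS₁ := isSuperposition_pmf (μ := μ) hX₁ hU₁ hU₁₁ hU₁₂
  have hS₂ := isSuperposition_pmf (μ := μ) hX₂ hU₂ hU₂₁ hU₂₂
  have hc₁ : ∑ c : Codebook n M₁ M₁₁ M₁₂ 𝒰₁ 𝒰₁₁ 𝒰₁₂, codebookProb μ U₁ U₁₁ U₁₂ c = 1 := by
    simp only [codebookProb_eq_bookLaw]
    exact sum_bookLaw (sum_iidLaw _ hS₁.sum_law) (sum_blockKernel hS₁.sum_eq_one₁)
      (sum_blockKernel hS₁.sum_eq_one₂)
  have hc₂ : ∑ c : Codebook n M₂ M₂₁ M₂₂ 𝒰₂ 𝒰₂₁ 𝒰₂₂, codebookProb μ U₂ U₂₁ U₂₂ c = 1 := by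
    simp only [codebookProb_eq_bookLaw]
    exact sum_bookLaw (sum_iidLaw _ hS₂.sum_law) (sum_blockKernel hS₂.sum_eq_one₁)
      (sum_blockKernel hS₂.sum_eq_one₂)
  have hx : ∑ x₁ : Fin n → 𝒳₁, ∑ x₂ : Fin n → 𝒳₂,
      ∏ t, pmf μ (fun ω => (X₁ ω, X₂ ω)) (x₁ t, x₂ t) = 1 := by
    have e : ∀ x₁ : Fin n → 𝒳₁, ∑ x₂ : Fin n → 𝒳₂,
        ∏ t, pmf μ (fun ω => (X₁ ω, X₂ ω)) (x₁ t, x₂ t) = iidLaw (pmf μ X₁) x₁ := fun x₁ => by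
      simp only [iidLaw, ← sum_pmf_prodMk hX₁ hX₂]
      exact sum_prod_pi fun t x₂ => pmf μ (fun ω => (X₁ ω, X₂ ω)) (x₁ t, x₂)
    simp only [e]
    exact sum_iidLaw _ (sum_pmf hX₁)
  have htotal : ∑ c₁ : Codebook n M₁ M₁₁ M₁₂ 𝒰₁ 𝒰₁₁ 𝒰₁₂,
      ∑ c₂ : Codebook n M₂ M₂₁ M₂₂ 𝒰₂ 𝒰₂₁ 𝒰₂₂, ∑ x₁ : Fin n → 𝒳₁, ∑ x₂ : Fin n → 𝒳₂,
      codebookProb μ U₁ U₁₁ U₁₂ c₁ * codebookProb μ U₂ U₂₁ U₂₂ c₂ *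
        ∏ t, pmf μ (fun ω => (X₁ ω, X₂ ω)) (x₁ t, x₂ t) = 1 := by
    simp only [← Finset.mul_sum, hx, mul_one, hc₂, hc₁]
  simp only [Fintype.sum_prod_type (α₂ := Fin n → 𝒳₁),
    Fintype.sum_prod_type (α₂ := Fin n → 𝒳₂)] at h
  have h' : ∑ c₁ : Codebook n M₁ M₁₁ M₁₂ 𝒰₁ 𝒰₁₁ 𝒰₁₂,
      ∑ c₂ : Codebook n M₂ M₂₁ M₂₂ 𝒰₂ 𝒰₂₁ 𝒰₂₂, ∑ x₁ : Fin n → 𝒳₁, ∑ x₂ : Fin n → 𝒳₂,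
      codebookProb μ U₁ U₁₁ U₁₂ c₁ * codebookProb μ U₂ U₂₁ U₂₂ c₂ *
        (∏ t, pmf μ (fun ω => (X₁ ω, X₂ ω)) (x₁ t, x₂ t)) *
        (if StronglyTypical ε
            (pmf μ fun ω => (X₁ ω, X₂ ω, U₁ ω, U₂ ω, U₁₁ ω, U₁₂ ω, U₂₁ ω, U₂₂ ω))
            (zip₈ x₁ x₂ (Book.word c₁ (g₁ (c₁, x₁))) (Book.word c₂ (g₂ (c₂, x₂)))) then 0 else 1)
        ≤ θ := by
    refine le_trans (le_of_eq (Finset.sum_congr rfl fun c₁ _ => Finset.sum_comm)) h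
  refine (sub_le_sub_left h' 1).trans (le_of_eq ?_)
  refine (congrArg₂ (· - ·) htotal.symm rfl).trans ?_
  unfold successProb
  simp only [← Finset.sum_sub_distrib]
  refine Finset.sum_congr rfl fun c₁ _ => Finset.sum_congr rfl fun c₂ _ =>
    Finset.sum_congr rfl fun x₁ _ => Finset.sum_congr rfl fun x₂ _ => ?_
  unfold zip₈
  split_ifs <;> ring

theorem lemma3 :
    ∃ δ : ℝ → ℝ, Tendsto δ (𝓝[>] 0) (𝓝 0) ∧
    ∀ {Ω 𝒳₁ 𝒳₂ 𝒰₁ 𝒰₂ 𝒰₁₁ 𝒰₁₂ 𝒰₂₁ 𝒰₂₂ : Type*} [MeasurableSpace Ω]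
      [Fintype 𝒳₁] [Fintype 𝒳₂] [Fintype 𝒰₁] [Fintype 𝒰₂]
      [Fintype 𝒰₁₁] [Fintype 𝒰₁₂] [Fintype 𝒰₂₁] [Fintype 𝒰₂₂]
      (μ : Measure Ω) [IsProbabilityMeasure μ]
      (X₁ : Ω → 𝒳₁) (X₂ : Ω → 𝒳₂) (U₁ : Ω → 𝒰₁) (U₂ : Ω → 𝒰₂)
      (U₁₁ : Ω → 𝒰₁₁) (U₁₂ : Ω → 𝒰₁₂) (U₂₁ : Ω → 𝒰₂₁) (U₂₂ : Ω → 𝒰₂₂),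
      Measurable[_, ⊤] X₁ → Measurable[_, ⊤] X₂ →
      Measurable[_, ⊤] U₁ → Measurable[_, ⊤] U₂ →
      Measurable[_, ⊤] U₁₁ → Measurable[_, ⊤] U₁₂ →
      Measurable[_, ⊤] U₂₁ → Measurable[_, ⊤] U₂₂ →
      MarkovChain₄ μ (fun ω => (U₁ ω, U₁₁ ω, U₁₂ ω)) X₁ X₂ (fun ω => (U₂ ω, U₂₁ ω, U₂₂ ω)) →
      ∀ (R₁ R₁₁ R₁₂ R₂ R₂₁ R₂₂ : ℝ),
      0 ≤ R₁ → 0 ≤ R₁₁ → 0 ≤ R₁₂ → 0 ≤ R₂ → 0 ≤ R₂₁ → 0 ≤ R₂₂ →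
      R₁ > mutualInfo μ X₁ U₁ →
      R₂ > mutualInfo μ X₂ U₂ →
      R₁ + R₁₁ > mutualInfo μ X₁ (fun ω => (U₁₁ ω, U₁ ω)) →
      R₁ + R₁₂ > mutualInfo μ X₁ (fun ω => (U₁₂ ω, U₁ ω)) →
      R₂ + R₂₁ > mutualInfo μ X₂ (fun ω => (U₂₁ ω, U₂ ω)) →
      R₂ + R₂₂ > mutualInfo μ X₂ (fun ω => (U₂₂ ω, U₂ ω)) →
      R₁ + R₁₁ + R₁₂ > mutualInfo μ X₁ (fun ω => (U₁₁ ω, U₁₂ ω, U₁ ω))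
        + condMutualInfo μ U₁₁ U₁₂ U₁ →
      R₂ + R₂₂ + R₂₁ > mutualInfo μ X₂ (fun ω => (U₂₁ ω, U₂₂ ω, U₂ ω))
        + condMutualInfo μ U₂₁ U₂₂ U₂ →
      ∀ ε > 0, ∃ N : ℕ, ∀ n ≥ N,
        ∃ (e₁ : Codebook n (codebookSize n R₁) (codebookSize n R₁₁) (codebookSize n R₁₂)
              𝒰₁ 𝒰₁₁ 𝒰₁₂ → Encoder n 𝒳₁ 𝒰₁ 𝒰₁₁ 𝒰₁₂)
          (e₂ : Codebook n (codebookSize n R₂) (codebookSize n R₂₁) (codebookSize n R₂₂)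
              𝒰₂ 𝒰₂₁ 𝒰₂₂ → Encoder n 𝒳₂ 𝒰₂ 𝒰₂₁ 𝒰₂₂),
          (∀ c, (e₁ c).SelectsFrom c) ∧ (∀ c, (e₂ c).SelectsFrom c) ∧
          successProb μ X₁ X₂ U₁ U₂ U₁₁ U₁₂ U₂₁ U₂₂ ε e₁ e₂ ≥ 1 - δ ε := by
  classical
  -- For each fixed `ε` the failure probability tends to zero, so it is eventually below any
  -- positive target. The target `ε` itself gives `δ = id`.
  refine ⟨id, tendsto_id.mono_left nhdsWithin_le_nhds, ?_⟩
  intro Ω 𝒳₁ 𝒳₂ 𝒰₁ 𝒰₂ 𝒰₁₁ 𝒰₁₂ 𝒰₂₁ 𝒰₂₂ _ _ _ _ _ _ _ _ _ μ _ X₁ X₂ U₁ U₂ U₁₁ U₁₂ U₂₁ U₂₂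
    hX₁ hX₂ hU₁ hU₂ hU₁₁ hU₁₂ hU₂₁ hU₂₂ hMarkov R₁ R₁₁ R₁₂ R₂ R₂₁ R₂₂
    hR₁ hR₁₁ hR₁₂ hR₂ hR₂₁ hR₂₂ i₁₀ i₂₀ i₁₁ i₁₂ i₂₁ i₂₂ i₁₃ i₂₃ ε hε
  have hA₁ := measurable_prodMk_top hU₁ (measurable_prodMk_top hU₁₁ hU₁₂)
  have hA₂ := measurable_prodMk_top hU₂ (measurable_prodMk_top hU₂₁ hU₂₂)
  have hZ₁ := measurable_prodMk_top hX₁ hA₁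
  have hZ₂ := measurable_prodMk_top hX₂ hA₂
  have hS₁ := isSuperposition_pmf (μ := μ) hX₁ hU₁ hU₁₁ hU₁₂
  have hS₂ := isSuperposition_pmf (μ := μ) hX₂ hU₂ hU₂₁ hU₂₂
  rw [mutualInfo_codeword hX₁ hU₁ hU₁₁ hU₁₂] at i₁₀
  rw [mutualInfo_satellite₁ hX₁ hU₁ hU₁₁ hU₁₂] at i₁₁
  rw [mutualInfo_satellite₂ hX₁ hU₁ hU₁₁ hU₁₂] at i₁₂
  rw [mean_density₀ hX₁ hU₁ hU₁₁ hU₁₂] at i₁₃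
  rw [mutualInfo_codeword hX₂ hU₂ hU₂₁ hU₂₂] at i₂₀
  rw [mutualInfo_satellite₁ hX₂ hU₂ hU₂₁ hU₂₂] at i₂₁
  rw [mutualInfo_satellite₂ hX₂ hU₂ hU₂₁ hU₂₂] at i₂₂
  rw [mean_density₀ hX₂ hU₂ hU₂₁ hU₂₂] at i₂₃
  rw [add_right_comm] at i₂₃
  have gap : ∀ {a b : ℝ}, b > a → ∀ᶠ Δ in 𝓝[>] (0 : ℝ), a + Δ ≤ b := by
    intro a b hab
    filter_upwards [Ioo_mem_nhdsGT (sub_pos.2 hab)] with Δ hΔ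
    linarith [hΔ.2]
  -- One margin `Δ` serves all eight strict rate inequalities.
  obtain ⟨Δ, hΔ, k₁₀, k₁₁, k₁₂, k₁₃, k₂₀, k₂₁, k₂₂, k₂₃⟩ :=
    (eventually_mem_nhdsWithin.and ((gap i₁₀).and ((gap i₁₁).and ((gap i₁₂).and ((gap i₁₃).and
      ((gap i₂₀).and ((gap i₂₁).and ((gap i₂₂).and (gap i₂₃))))))))).exists
  have hfst₁ : ∀ x, marginal (pmf μ fun ω => (X₁ ω, U₁ ω, U₁₁ ω, U₁₂ ω)) Prod.fst x = pmf μ X₁ x :=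
    fun x => (pmf_comp hZ₁ Prod.fst x).symm
  have hfst₂ : ∀ x, marginal (pmf μ fun ω => (X₂ ω, U₂ ω, U₂₁ ω, U₂₂ ω)) Prod.fst x = pmf μ X₂ x :=
    fun x => (pmf_comp hZ₂ Prod.fst x).symm
  have hall := measurable_prodMk_top hX₁ (measurable_prodMk_top hX₂ (measurable_prodMk_top hU₁
    (measurable_prodMk_top hU₂ (measurable_prodMk_top hU₁₁ (measurable_prodMk_top hU₁₂
    (measurable_prodMk_top hU₂₁ hU₂₂))))))
  obtain ⟨N, hN⟩ := eventually_atTop.1 (eventually_exists_choices hS₁ hS₂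
    (r := pmf μ fun ω => (X₁ ω, X₂ ω)) (pmf_nonneg _)
    (fun x₁ => by rw [hfst₁, sum_pmf_prodMk hX₁ hX₂])
    (fun x₂ => by
      rw [hfst₂, ← sum_pmf_prodMk hX₂ hX₁]
      exact Finset.sum_congr rfl fun x₁ _ => pmf_congr fun ω => by
        simp only [Prod.mk.injEq]
        tauto)
    (p := pmf μ fun ω => (X₁ ω, X₂ ω, U₁ ω, U₂ ω, U₁₁ ω, U₁₂ ω, U₂₁ ω, U₂₂ ω))
    (pmf_nonneg _) (sum_pmf hall)
    (fun x₁ x₂ u₁ u₂ v₁ w₁ v₂ w₂ => by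
      rw [hfst₁, hfst₂]
      refine (hMarkov.pmf_eq hA₁ hX₁ hX₂ hA₂ (u₁, v₁, w₁) x₁ x₂ (u₂, v₂, w₂)).trans ?_
      exact pmf_congr fun ω => by
        simp only [Prod.mk.injEq]
        tauto)
    hR₁ hR₁₁ hR₁₂ hR₂ hR₂₁ hR₂₂ hΔ k₁₀ k₁₁ k₁₂ k₁₃ k₂₀ k₂₁ k₂₂ k₂₃ hε hε
    (B := fun n s => if StronglyTypical ε
      (pmf μ fun ω => (X₁ ω, X₂ ω, U₁ ω, U₂ ω, U₁₁ ω, U₁₂ ω, U₂₁ ω, U₂₂ ω)) s then 0 else 1)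
    (fun n s => by positivity) (fun n s => by split_ifs <;> norm_num)
    (fun n s hs => if_pos hs))
  refine ⟨N, fun n hn => ?_⟩
  obtain ⟨g₁, g₂, hg⟩ := hN n hn
  -- The satellite maps of these encoders ignore their second argument: the index triple is selected
  -- at once from the codebook and the source block.
  refine ⟨_, _, ?_, ?_, one_sub_le_successProb hX₁ hX₂ hU₁ hU₂ hU₁₁ hU₁₂ hU₂₁ hU₂₂ g₁ g₂ ?_⟩
  · exact fun c x => ⟨_, _, _, rfl, rfl, rfl⟩
  · exact fun c x => ⟨_, _, _, rfl, rfl, rfl⟩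
  · simp only [codebookProb_eq_bookLaw]
    exact hg.trans_eq' (by congr!)
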